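/- Let $\mu$ be a finite positive Borel measure on $\mathbb{R}$ with infinite support and finite moments of all orders, supported on an interval $I\subset\mathbb{R}$ with $c=\inf I\in\mathbb{R}$. Let $r\ge 0$ be an integer and $M_0,\dots,M_r>0$. For $j=0,1,\dots,r+1$ let $\{p_n^{[2j]}\}_{n\ge0}$ be the sequence of orthonormal polynomials (with $\deg p_n^{[2j]}=n$ and positive leading coefficients) with respect to the measure $(x-c)^{2j}\,d\mu(x)$, and let $\{q_n\}_{n\ge0}$ be the sequence of orthonormal polynomials (with $\deg q_n=n$ and positive leading coefficients) with respect to the inner product $$\langle p,q\rangle=\int p(x)q(x)\,d\mu(x)+\sum_{i=0}^{r}M_i\,p^{(i)}(c)\,q^{(i)}(c).$$ For $\nu>-1$ let $J_\nu(z)=\sum_{n=0}^\infty\frac{(-1)^n}{n!\,\Gamma(n+\nu+1)}\left(\frac z2\right)^{2n+\nu}$ be the Bessel function of order $\nu$; for $m=0,1,2,\dots$ the function $z^{-\nu}J_{\nu+2m}(2z)$ is understood as the entire function that it defines (with its limit as value at $z=0$). Suppose that there are a real number $\nu>-1$ and real sequences $(a_n)$, $(b_n)$ such that, for every $j=0,1,\dots,r+1$,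 $$\lim_{n\to\infty}(-1)^n\frac{a_n^{1/2}}{b_n^{j}}\,p_n^{[2j]}\!\left(c+\frac{z^2}{b_n}\right)=z^{-(\nu+2j)}J_{\nu+2j}(2z)$$ uniformly on compact subsets of $\mathbb{C}$, where, for some real numbers $a$ and $A,B,b>0$, $$\lim_{n\to\infty}\frac{a_n^{-1/2}}{A\,n^{a}}=1,\qquad \lim_{n\to\infty}\frac{b_n}{B\,n^{b}}=1,\qquad 2a+1=b(\nu+1).$$ Then $$\lim_{n\to\infty}(-1)^n a_n^{1/2}\,q_n\!\left(c+\frac{z^2}{b_n}\right)=(-1)^{r+1}z^{-\nu}J_{\nu+2r+2}(2z)$$ uniformly on compact subsets of $\mathbb{C}$. Moreover, for every $n\ge r+1$ there exist real coefficients $\lambda_{0,n},\dots,\lambda_{r+1,n}$ with $$q_n(x)=\sum_{j=0}^{r+1}\lambda_{j,n}\,(x-c)^j\,p_{n-j}^{[2j]}(x),$$ and any coefficients for which this formula holds for all sufficiently large $n$ satisfy $\lim_n\lambda_{j,n}=0$ for $j=0,\dots,r$ and $\lim_n\lambda_{r+1,n}=1$. -/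

import Mathlib

open Polynomial MeasureTheory Filter Topology

noncomputable section

/-- `P` is the sequence of orthonormal polynomials with respect to the symmetric bilinear form `B`:
`P n` has degree `n`, positive leading coefficient, and `B (P m) (P n) = δ_{mn}`. -/
structure IsOrthonormalPolynomials (B : ℝ[X] → ℝ[X] → ℝ) (P : ℕ → ℝ[X]) : Prop where
  natDegree_eq : ∀ n, (P n).natDegree = n
  leadingCoeff_pos : ∀ n, 0 < (P n).leadingCoeff
  orthonormal : ∀ m n, B (P m) (P n) = if m = n then 1 else 0

/-- `∫ p q dμ`. -/
def integralForm (μ : Measure ℝ) (p q : ℝ[X]) : ℝ :=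
  ∫ x, p.eval x * q.eval x ∂μ

/-- `∫ p q dμ + ∑_{i=0}^r M_i p^{(i)}(c) q^{(i)}(c)`. -/
def sobolevForm (μ : Measure ℝ) (c : ℝ) (r : ℕ) (M : ℕ → ℝ) (p q : ℝ[X]) : ℝ :=
  ∫ x, p.eval x * q.eval x ∂μ +
    ∑ i ∈ Finset.range (r + 1), M i * (derivative^[i] p).eval c * (derivative^[i] q).eval c

/-- The measure `dμ_{2j}(x) = (x - c)^{2j} dμ(x)`. -/
def christoffelMeasure (μ : Measure ℝ) (c : ℝ) (j : ℕ) : Measure ℝ :=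
  μ.withDensity fun x => ENNReal.ofReal ((x - c) ^ (2 * j))

/-- The Bessel function `J_ν` of real order `ν > -1` (principal branch of the power). -/
def besselJ (ν : ℝ) (z : ℂ) : ℂ :=
  ∑' n : ℕ, ((-1) ^ n / ((n.factorial : ℂ) * (Real.Gamma (n + ν + 1) : ℂ))) *
    (z / 2) ^ ((2 * n + ν : ℝ) : ℂ)

/-- The function `z ↦ z^{-σ} J_τ(2z)` with its removable singularity at `z = 0` removed,
that is, its value at `0` is its limit there. It is used for `τ - σ = 0, 2, 4, …`, where
it is entire (see `besselQuot_eq`). -/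
def besselQuot (σ τ : ℝ) : ℂ → ℂ :=
  Function.update (fun z : ℂ => z ^ (-σ : ℂ) * besselJ τ (2 * z)) 0
    (limUnder (𝓝[≠] (0 : ℂ)) fun z : ℂ => z ^ (-σ : ℂ) * besselJ τ (2 * z))

/-- Uniform convergence on all compact subsets of `ℂ`. -/
def TendstoUniformlyOnCompacts (F : ℕ → ℂ → ℂ) (f : ℂ → ℂ) : Prop :=
  ∀ K : Set ℂ, IsCompact K → TendstoUniformlyOn F f atTop K

theorem besselJ_coeff_summable {τ : ℝ} (hτ : -1 < τ) (R : ℝ) :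
    Summable fun n : ℕ => ((n.factorial : ℝ) * Real.Gamma (n + τ + 1))⁻¹ * R ^ (2 * n) := by
  have hpos : ∀ n : ℕ, 0 < Real.Gamma (n + τ + 1) := fun n =>
    Real.Gamma_pos_of_pos (by have : (0 : ℝ) ≤ n := n.cast_nonneg; linarith)
  have hge : ∀ n : ℕ, min 1 (τ + 1) * Real.Gamma (τ + 1) ≤ Real.Gamma (n + τ + 1) := by
    intro n
    have h0 : 0 < Real.Gamma (τ + 1) := Real.Gamma_pos_of_pos (by linarith)
    have hm : 0 < min 1 (τ + 1) := lt_min one_pos (by linarith)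
    rcases n with _ | n
    · have := mul_le_mul_of_nonneg_right (min_le_left 1 (τ + 1)) h0.le
      simpa using this
    · induction n with
      | zero =>
        have h1 : ((0 + 1 : ℕ) : ℝ) + τ + 1 = (τ + 1) + 1 := by push_cast; ring
        rw [h1, Real.Gamma_add_one (s := τ + 1) (by linarith)]
        exact mul_le_mul_of_nonneg_right (min_le_right _ _) h0.le
      | succ k ih =>
        have h1 : ((k + 1 + 1 : ℕ) : ℝ) + τ + 1 = (((k + 1 : ℕ) : ℝ) + τ + 1) + 1 := by
          push_cast; ring
        have hk : (0 : ℝ) ≤ k := k.cast_nonneg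
        have h2 : (1 : ℝ) ≤ ((k + 1 : ℕ) : ℝ) + τ + 1 := by push_cast; linarith
        rw [h1, Real.Gamma_add_one (s := ((k + 1 : ℕ) : ℝ) + τ + 1) (by linarith)]
        nlinarith [hpos (k + 1)]
  set δ := min 1 (τ + 1) * Real.Gamma (τ + 1) with hδ
  have hδ0 : 0 < δ :=
    mul_pos (lt_min one_pos (by linarith)) (Real.Gamma_pos_of_pos (by linarith))
  refine Summable.of_nonneg_of_le (fun n => ?_) (fun n => ?_)
    ((Real.summable_pow_div_factorial (R ^ 2)).mul_left δ⁻¹)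
  · rw [pow_mul]
    have := hpos n
    positivity
  · rw [mul_inv, pow_mul]
    have hR : 0 ≤ (R ^ 2) ^ n := by positivity
    have hi : (Real.Gamma (n + τ + 1))⁻¹ ≤ δ⁻¹ := inv_anti₀ hδ0 (hge n)
    have hf : 0 ≤ ((n.factorial : ℝ))⁻¹ := by positivity
    calc ((n.factorial : ℝ))⁻¹ * (Real.Gamma (n + τ + 1))⁻¹ * (R ^ 2) ^ n
        ≤ ((n.factorial : ℝ))⁻¹ * δ⁻¹ * (R ^ 2) ^ n := by gcongr
      _ = δ⁻¹ * ((R ^ 2) ^ n / n.factorial) := by field_simp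

theorem besselQuot_eq {σ τ : ℝ} {m : ℕ} (hτ : -1 < τ) (h : τ = σ + 2 * m) (z : ℂ) :
    besselQuot σ τ z = z ^ (2 * m) * ∑' n : ℕ,
      ((-1) ^ n / ((n.factorial : ℂ) * (Real.Gamma (n + τ + 1) : ℂ))) * z ^ (2 * n) := by
  set g : ℂ → ℂ := fun z => z ^ (2 * m) * ∑' n : ℕ,
      ((-1) ^ n / ((n.factorial : ℂ) * (Real.Gamma (n + τ + 1) : ℂ))) * z ^ (2 * n) with hg
  have hne : ∀ w : ℂ, w ≠ 0 → w ^ (-σ : ℂ) * besselJ τ (2 * w) = g w := by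
    intro w hw
    simp only [hg, besselJ]
    rw [← tsum_mul_left, ← tsum_mul_left]
    refine tsum_congr fun n => ?_
    have h2 : (2 * w / 2) = w := by ring
    have h3 : w ^ (-σ : ℂ) * w ^ ((2 * n + τ : ℝ) : ℂ) = w ^ (2 * m) * w ^ (2 * n) := by
      rw [← Complex.cpow_add _ _ hw, ← pow_add, ← Complex.cpow_natCast]
      congr 1
      rw [h]
      push_cast
      ring
    rw [h2]
    calc _ = ((-1) ^ n / ((n.factorial : ℂ) * (Real.Gamma (n + τ + 1) : ℂ))) *
          (w ^ (-σ : ℂ) * w ^ ((2 * n + τ : ℝ) : ℂ)) := by ring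
      _ = _ := by rw [h3]; ring
  have hcont : ContinuousAt g 0 := by
    have hc : ContinuousOn (fun z : ℂ => ∑' n : ℕ,
        ((-1) ^ n / ((n.factorial : ℂ) * (Real.Gamma (n + τ + 1) : ℂ))) * z ^ (2 * n))
        (Metric.closedBall 0 1) := by
      refine continuousOn_tsum (fun n => by fun_prop) (besselJ_coeff_summable hτ 1) ?_
      intro n x hx
      have hx1 : ‖x‖ ≤ 1 := by simpa using hx
      have hp : 0 < Real.Gamma (n + τ + 1) :=
        Real.Gamma_pos_of_pos (by have : (0 : ℝ) ≤ n := n.cast_nonneg; linarith)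
      rw [norm_mul, norm_div, norm_mul, norm_pow, norm_pow, norm_neg, norm_one, one_pow,
        Complex.norm_natCast, Complex.norm_real, Real.norm_of_nonneg hp.le, one_div]
      gcongr
    exact (continuous_pow _).continuousAt.mul
      (hc.continuousAt (Metric.closedBall_mem_nhds 0 one_pos))
  have hev : (fun z : ℂ => z ^ (-σ : ℂ) * besselJ τ (2 * z)) =ᶠ[𝓝[≠] 0] g := by
    filter_upwards [self_mem_nhdsWithin] with w hw using hne w hw
  have hlim : limUnder (𝓝[≠] (0 : ℂ)) (fun z : ℂ => z ^ (-σ : ℂ) * besselJ τ (2 * z)) = g 0 :=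
    ((hcont.tendsto.mono_left nhdsWithin_le_nhds).congr' hev.symm).limUnder_eq
  change besselQuot σ τ z = g z
  rcases eq_or_ne z 0 with rfl | hz
  · rw [besselQuot, Function.update_self, hlim]
  · rw [besselQuot, Function.update_of_ne hz, hne z hz]

end

/-! ### Orthonormal polynomials with respect to a bilinear form -/

section OrthonormalPolynomials

variable {B : ℝ[X] →ₗ[ℝ] ℝ[X] →ₗ[ℝ] ℝ} {P : ℕ → ℝ[X]}

/-! Write `P n` for `p 0 n`, and κ_n for the integral of q_n P_n against μ. The theorem rests on the
vanishing of the low Taylor coefficients of q_n at c, relative to those of P_n.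

Sobolev orthogonality of q_n to P_m, m < n, expresses each Fourier coefficient of q_n as minus a
combination of the Taylor coefficients of P_m, with weights u_i = M_i (i!)² (q_n)_i, where (q_n)_i
is the i-th Taylor coefficient of q_n at c. Put η_n = Σ u_i (P_n)_i. Comparing leading coefficients
gives κ_n (κ_n + η_n) = 1, and Parseval with ∫ q_n² dμ ≤ 1 gives Σ_{m<n} (Σ_i u_i (P_m)_i)² ≤ κ_n
η_n (`sobolev_energy`). The left side is a quadratic form in u. By the Mehler–Heine hypothesis
(P_m)_i grows like (-1)^m E_i m^(a+ib) with E_i ≠ 0, so the rescaled Gram matrix tends to a diagonal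
conjugate of a Cauchy matrix 1/(ν+1+i+j), which is positive definite. Quadratic growth on the left
against linear growth on the right forces the rescaled u to be O(1/n)
(`exists_scaled_sobolev_bound`). Hence κ_n → 1 and (q_n)_k = o(n^(a+kb)) for k ≤ r.

The connection formula is algebraic: peel off the terms j ≤ r by matching values at c, then
recognise the remaining quotient as a multiple of `p (r+1) (n-r-1)` by orthogonality
(`exists_connection_formula`). Reading off Taylor coefficients of order at most r gives a lower
triangular system whose solution tends to 0 (`tendsto_zero_of_triangular`); the last coefficient is
squeezed to 1 by pairing with P_n and with the last basis element (`tendsto_last_connection_coeff`).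
Only the last term then survives in the Mehler–Heine limit (`mehlerHeine_of_connection`). -/

theorem IsOrthonormalPolynomials.coeff_pos {F : ℝ[X] → ℝ[X] → ℝ}
    (hP : IsOrthonormalPolynomials F P) (n : ℕ) : 0 < (P n).coeff n := by
  have := hP.leadingCoeff_pos n
  rwa [leadingCoeff, hP.natDegree_eq] at this

theorem IsOrthonormalPolynomials.degree_eq {F : ℝ[X] → ℝ[X] → ℝ}
    (hP : IsOrthonormalPolynomials F P) (n : ℕ) : (P n).degree = n := by
  rw [degree_eq_natDegree (leadingCoeff_ne_zero.mp (hP.leadingCoeff_pos n).ne'), hP.natDegree_eq]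

theorem IsOrthonormalPolynomials.degree_sub_lt {F : ℝ[X] → ℝ[X] → ℝ}
    (hP : IsOrthonormalPolynomials F P) {n : ℕ} {f : ℝ[X]} (hf : f.degree < (n + 1 : ℕ)) :
    (f - (f.coeff n / (P n).coeff n) • P n).degree < n := by
  rw [degree_lt_iff_coeff_zero] at hf ⊢
  intro m hm
  rcases hm.eq_or_lt with rfl | hm
  · simp [(hP.coeff_pos n).ne']
  · rw [coeff_sub, coeff_smul, hf m hm,
      coeff_eq_zero_of_degree_lt (n := m) (p := P n) (by rw [hP.degree_eq]; exact_mod_cast hm)]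
    simp

theorem IsOrthonormalPolynomials.apply_eq_zero
    (hP : IsOrthonormalPolynomials (fun f g => B f g) P) {n : ℕ} {f : ℝ[X]}
    (hf : f.degree < n) : B f (P n) = 0 := by
  -- The degree bound must vary in the induction while the index of `P n` stays fixed.
  suffices H : ∀ m ≤ n, ∀ f : ℝ[X], f.degree < m → B f (P n) = 0 from H n le_rfl f hf
  intro m
  induction m with
  | zero =>
    intro _ f hf
    have : f = 0 := by
      ext k
      exact coeff_eq_zero_of_degree_lt (hf.trans_le (by exact_mod_cast k.zero_le))
    simp [this]
  | succ m ih =>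
    intro hm f hf
    have h1 := ih (by omega) _ (hP.degree_sub_lt hf)
    have h2 := hP.orthonormal m n
    rw [if_neg (by omega)] at h2
    simpa [h2] using h1

/-- Only the leading term survives pairing with `P n`. Applied to two families in both directions,
this produces reciprocal ratios of leading coefficients. -/
theorem IsOrthonormalPolynomials.apply_eq_div
    (hP : IsOrthonormalPolynomials (fun f g => B f g) P) {n : ℕ} {f : ℝ[X]}
    (hf : f.degree < (n + 1 : ℕ)) : B f (P n) = f.coeff n / (P n).coeff n := by
  have h1 := hP.apply_eq_zero (hP.degree_sub_lt hf)
  have h2 := hP.orthonormal n n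
  simp only [if_true] at h2
  rw [map_sub, map_smul, LinearMap.sub_apply, LinearMap.smul_apply, h2, smul_eq_mul, mul_one,
    sub_eq_zero] at h1
  exact h1

/-- The Fourier expansion of a polynomial of degree less than `n`. -/
theorem IsOrthonormalPolynomials.eq_sum
    (hP : IsOrthonormalPolynomials (fun f g => B f g) P) {n : ℕ} {f : ℝ[X]}
    (hf : f.degree < n) : f = ∑ m ∈ Finset.range n, B f (P m) • P m := by
  induction n generalizing f with
  | zero =>
    ext k
    simpa using coeff_eq_zero_of_degree_lt (hf.trans_le (by exact_mod_cast k.zero_le))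
  | succ n ih =>
    have h1 := ih (hP.degree_sub_lt hf)
    rw [← hP.apply_eq_div hf] at h1
    rw [Finset.sum_range_succ, ← sub_eq_iff_eq_add, h1]
    refine Finset.sum_congr rfl fun m hm => ?_
    have h2 := hP.orthonormal n m
    rw [if_neg (by have := Finset.mem_range.mp hm; omega)] at h2
    simp [h2]

/-- A polynomial of degree at most `n` orthogonal to everything of smaller degree is a multiple
of `P n`. -/
theorem IsOrthonormalPolynomials.eq_smul
    (hP : IsOrthonormalPolynomials (fun f g => B f g) P) {n : ℕ} {f : ℝ[X]}
    (hf : f.degree < (n + 1 : ℕ)) (h : ∀ m < n, B f (P m) = 0) : f = B f (P n) • P n := by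
  conv_lhs => rw [hP.eq_sum hf, Finset.sum_range_succ,
    Finset.sum_eq_zero fun m hm => by rw [h m (Finset.mem_range.mp hm), zero_smul], zero_add]

theorem IsOrthonormalPolynomials.parseval
    (hP : IsOrthonormalPolynomials (fun f g => B f g) P) {n : ℕ} {f : ℝ[X]}
    (hf : f.degree < n) : B f f = ∑ m ∈ Finset.range n, B f (P m) ^ 2 := by
  refine (congrArg (B f) (hP.eq_sum hf)).trans ?_
  rw [map_sum]
  exact Finset.sum_congr rfl fun m _ => by rw [map_smul, smul_eq_mul, sq]

end OrthonormalPolynomials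

/-! ### The bilinear forms of the problem -/

section Forms

variable {μ : Measure ℝ}

theorem integrable_eval (hμ : ∀ n : ℕ, Integrable (fun x : ℝ => x ^ n) μ) (f : ℝ[X]) :
    Integrable (fun x => f.eval x) μ := by
  simp_rw [eval_eq_sum_range]
  exact integrable_finsetSum _ fun i _ => (hμ i).const_mul _

theorem integrable_eval_mul (hμ : ∀ n : ℕ, Integrable (fun x : ℝ => x ^ n) μ) (f g : ℝ[X]) :
    Integrable (fun x => f.eval x * g.eval x) μ := by
  simpa using integrable_eval hμ (f * g)

/-- `integralForm` as a bilinear map. -/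
noncomputable def integralBilin (μ : Measure ℝ)
    (hμ : ∀ n : ℕ, Integrable (fun x : ℝ => x ^ n) μ) : ℝ[X] →ₗ[ℝ] ℝ[X] →ₗ[ℝ] ℝ :=
  LinearMap.mk₂ ℝ (integralForm μ)
    (fun f g h => by
      simp only [integralForm, eval_add, add_mul]
      exact integral_add (integrable_eval_mul hμ f h) (integrable_eval_mul hμ g h))
    (fun a f g => by
      simp only [integralForm, eval_smul, smul_eq_mul, mul_assoc]
      exact integral_const_mul _ _)
    (fun f g h => by
      simp only [integralForm, eval_add, mul_add]
      exact integral_add (integrable_eval_mul hμ f g) (integrable_eval_mul hμ f h))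
    (fun a f g => by
      simp only [integralForm, eval_smul, smul_eq_mul, mul_left_comm _ a]
      exact integral_const_mul _ _)

variable (hμ : ∀ n : ℕ, Integrable (fun x : ℝ => x ^ n) μ)

theorem integralBilin_apply (f g : ℝ[X]) : integralBilin μ hμ f g = ∫ x, f.eval x * g.eval x ∂μ :=
  rfl

theorem integralBilin_comm (f g : ℝ[X]) : integralBilin μ hμ f g = integralBilin μ hμ g f := by
  simp only [integralBilin_apply, mul_comm]

theorem integralBilin_self_nonneg (f : ℝ[X]) : 0 ≤ integralBilin μ hμ f f :=
  integral_nonneg fun _ => mul_self_nonneg _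

/-- Nonnegativity of the form at `f - g` is all of Cauchy–Schwarz that is needed. -/
theorem integralBilin_le_one {f g : ℝ[X]} (hf : integralBilin μ hμ f f ≤ 1)
    (hg : integralBilin μ hμ g g ≤ 1) : integralBilin μ hμ f g ≤ 1 := by
  have h := integralBilin_self_nonneg hμ (f - g)
  simp only [map_sub, LinearMap.sub_apply, integralBilin_comm hμ g f] at h
  linarith

theorem integralBilin_abs_le_one {f g : ℝ[X]} (hf : integralBilin μ hμ f f ≤ 1)
    (hg : integralBilin μ hμ g g ≤ 1) : |integralBilin μ hμ f g| ≤ 1 := by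
  refine abs_le.mpr ⟨?_, integralBilin_le_one hμ hf hg⟩
  have := integralBilin_le_one hμ (f := -f) (g := g) (by simpa using hf) hg
  simp only [map_neg, LinearMap.neg_apply] at this
  linarith

/-- Moves the weight onto the polynomials, so that all the families are compared inside the single
form of μ. -/
theorem integralForm_christoffelMeasure (c : ℝ) (j : ℕ) (f g : ℝ[X]) :
    integralForm (christoffelMeasure μ c j) f g =
      integralForm μ ((X - C c) ^ j * f) ((X - C c) ^ j * g) := by
  rw [integralForm, christoffelMeasure, integral_withDensity_eq_integral_toReal_smul
    (by fun_prop) (Eventually.of_forall fun _ => ENNReal.ofReal_lt_top), integralForm]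
  congr 1 with x
  have : 0 ≤ (x - c) ^ (2 * j) := by rw [pow_mul]; positivity
  simp only [ENNReal.toReal_ofReal this, eval_mul, eval_pow, eval_sub, eval_X, eval_C, smul_eq_mul]
  ring

/-- The bilinear form `∫ f g (x - c)^{2j} dμ`. -/
noncomputable def christoffelBilin (c : ℝ) (j : ℕ) : ℝ[X] →ₗ[ℝ] ℝ[X] →ₗ[ℝ] ℝ :=
  (integralBilin μ hμ).compl₁₂ (LinearMap.mulLeft ℝ ((X - C c) ^ j))
    (LinearMap.mulLeft ℝ ((X - C c) ^ j))

theorem christoffelBilin_apply (c : ℝ) (j : ℕ) (f g : ℝ[X]) :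
    christoffelBilin hμ c j f g =
      integralBilin μ hμ ((X - C c) ^ j * f) ((X - C c) ^ j * g) := rfl

theorem IsOrthonormalPolynomials.christoffel {c : ℝ} {j : ℕ} {P : ℕ → ℝ[X]}
    (hP : IsOrthonormalPolynomials (integralForm (christoffelMeasure μ c j)) P) :
    IsOrthonormalPolynomials (fun f g => christoffelBilin hμ c j f g) P := by
  have : (fun f g => christoffelBilin hμ c j f g) = integralForm (christoffelMeasure μ c j) := by
    funext f g
    rw [integralForm_christoffelMeasure]
    rfl
  rwa [this]

/-- Taylor coefficients are preferred to derivatives because multiplication by `(X - C c) ^ j`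
merely shifts them. -/
theorem eval_iterate_derivative (c : ℝ) (i : ℕ) (f : ℝ[X]) :
    (derivative^[i] f).eval c = i.factorial * (taylor c f).coeff i := by
  rw [taylor_coeff, ← factorial_smul_hasseDeriv]
  simp

theorem sobolevForm_eq (c : ℝ) (r : ℕ) (M : ℕ → ℝ) (f g : ℝ[X]) :
    sobolevForm μ c r M f g = integralForm μ f g + ∑ i : Fin (r + 1),
      (M i * (i : ℕ).factorial ^ 2) * (taylor c f).coeff i * (taylor c g).coeff i := by
  rw [sobolevForm, integralForm, Finset.sum_range]
  congr 1
  refine Finset.sum_congr rfl fun i _ => ?_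
  rw [eval_iterate_derivative, eval_iterate_derivative]
  ring

/-- `sobolevForm` as a bilinear map. -/
noncomputable def sobolevBilin (c : ℝ) (r : ℕ) (M : ℕ → ℝ) : ℝ[X] →ₗ[ℝ] ℝ[X] →ₗ[ℝ] ℝ :=
  LinearMap.mk₂ ℝ (sobolevForm μ c r M)
    (fun f g h => by
      have := LinearMap.map_add₂ (integralBilin μ hμ) f g h
      change integralForm μ _ _ = integralForm μ _ _ + integralForm μ _ _ at this
      simp only [sobolevForm_eq, this, map_add, coeff_add, mul_add, add_mul,
        Finset.sum_add_distrib]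
      ring)
    (fun a f g => by
      have := LinearMap.map_smul₂ (integralBilin μ hμ) a f g
      change integralForm μ _ _ = _ * integralForm μ _ _ at this
      simp only [sobolevForm_eq, this, map_smul, coeff_smul, smul_eq_mul, mul_add, Finset.mul_sum]
      congr 1
      exact Finset.sum_congr rfl fun i _ => by ring)
    (fun f g h => by
      have := map_add (integralBilin μ hμ f) g h
      change integralForm μ _ _ = integralForm μ _ _ + integralForm μ _ _ at this
      simp only [sobolevForm_eq, this, map_add, coeff_add, mul_add,
        Finset.sum_add_distrib]
      ring)
    (fun a f g => by
      have := map_smul (integralBilin μ hμ f) a g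
      change integralForm μ _ _ = _ * integralForm μ _ _ at this
      simp only [sobolevForm_eq, this, map_smul, coeff_smul, smul_eq_mul, mul_add, Finset.mul_sum]
      congr 1
      exact Finset.sum_congr rfl fun i _ => by ring)

theorem sobolevBilin_apply (c : ℝ) (r : ℕ) (M : ℕ → ℝ) (f g : ℝ[X]) :
    sobolevBilin hμ c r M f g = integralBilin μ hμ f g + ∑ i : Fin (r + 1),
      (M i * (i : ℕ).factorial ^ 2) * (taylor c f).coeff i * (taylor c g).coeff i :=
  sobolevForm_eq c r M f g

theorem taylor_X_sub_C_pow_mul (c : ℝ) (j : ℕ) (f : ℝ[X]) :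
    taylor c ((X - C c) ^ j * f) = X ^ j * taylor c f := by
  simp [taylor_mul, taylor_pow]

theorem coeff_taylor_X_sub_C_pow_mul (c : ℝ) (j k : ℕ) (f : ℝ[X]) :
    (taylor c ((X - C c) ^ j * f)).coeff k = if j ≤ k then (taylor c f).coeff (k - j) else 0 := by
  rw [taylor_X_sub_C_pow_mul, coeff_X_pow_mul']

theorem degree_X_sub_C_pow_mul (c : ℝ) (j : ℕ) (f : ℝ[X]) :
    ((X - C c) ^ j * f).degree = j + f.degree := by
  rw [degree_mul, degree_pow, degree_X_sub_C, nsmul_one]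

theorem leadingCoeff_X_sub_C_pow_mul (c : ℝ) (j : ℕ) (f : ℝ[X]) :
    ((X - C c) ^ j * f).leadingCoeff = f.leadingCoeff := by
  rw [leadingCoeff_mul, leadingCoeff_pow, leadingCoeff_X_sub_C, one_pow, one_mul]

end Forms

/-! ### The connection formula -/

section Connection

variable {μ : Measure ℝ} (hμ : ∀ n : ℕ, Integrable (fun x : ℝ => x ^ n) μ)

theorem eq_zero_of_ae_eval_eq_zero (hinf : μ.support.Infinite) {f : ℝ[X]}
    (h : ∀ᵐ x ∂μ, f.eval x = 0) : f = 0 := by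
  by_contra hf
  refine hinf (Set.Finite.subset f.roots.toFinset.finite_toSet ?_)
  refine Measure.support_subset_of_isClosed f.roots.toFinset.finite_toSet.isClosed ?_
  filter_upwards [h] with x hx
  simpa [hf] using hx

/-- If P_n = (x-c)s, orthogonality to s makes ∫ s² (x-c)^(2j+1) dμ vanish. The integrand is
nonnegative because μ lives on x ≥ c, and infinite support then forces s = 0. -/
theorem IsOrthonormalPolynomials.eval_ne_zero (hinf : μ.support.Infinite) {c : ℝ}
    (hc : ∀ᵐ x ∂μ, c ≤ x) {j : ℕ} {P : ℕ → ℝ[X]}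
    (hP : IsOrthonormalPolynomials (fun f g => christoffelBilin hμ c j f g) P) (n : ℕ) :
    (P n).eval c ≠ 0 := by
  intro h0
  obtain ⟨s, hs⟩ := dvd_iff_isRoot.mpr h0
  have hPn : P n ≠ 0 := leadingCoeff_ne_zero.mp (hP.leadingCoeff_pos n).ne'
  have hs0 : s ≠ 0 := by rintro rfl; simp [hPn] at hs
  have hdeg : s.degree < n := by
    have h1 : (P n).natDegree = 1 + s.natDegree := by
      rw [hs, natDegree_mul (X_sub_C_ne_zero c) hs0, natDegree_X_sub_C]
    rw [hP.natDegree_eq] at h1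
    rw [degree_eq_natDegree hs0]
    exact_mod_cast (by omega : s.natDegree < n)
  have h1 := hP.apply_eq_zero hdeg
  rw [christoffelBilin_apply, integralBilin_apply] at h1
  have hnn : 0 ≤ᵐ[μ] fun x => ((X - C c) ^ j * s).eval x * ((X - C c) ^ j * P n).eval x := by
    filter_upwards [hc] with x hx
    have h2 : ((X - C c) ^ j * s).eval x * ((X - C c) ^ j * P n).eval x =
        ((x - c) ^ j * s.eval x) ^ 2 * (x - c) := by
      rw [hs]
      simp only [eval_mul, eval_pow, eval_sub, eval_X, eval_C]
      ring
    simp only [Pi.zero_apply, h2]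
    have := sub_nonneg.mpr hx
    positivity
  rw [integral_eq_zero_iff_of_nonneg_ae hnn (integrable_eval_mul hμ _ _)] at h1
  have h3 : ((X - C c) ^ j * s) * ((X - C c) ^ j * P n) = 0 := by
    refine eq_zero_of_ae_eval_eq_zero hinf ?_
    filter_upwards [h1] with x hx
    simpa using hx
  simp [hs0, hPn, X_sub_C_ne_zero] at h3

/-- Each step subtracts the multiple of `e k` that cancels the value of the current quotient at c,
then divides by `X - C c`. -/
theorem exists_triangular_expansion {c : ℝ} {e : ℕ → ℝ[X]} {k : ℕ}
    (he : ∀ j < k, (e j).eval c ≠ 0) (f : ℝ[X]) :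
    ∃ (l : ℕ → ℝ) (s : ℝ[X]),
      f = ∑ j ∈ Finset.range k, C (l j) * (X - C c) ^ j * e j + (X - C c) ^ k * s := by
  induction k with
  | zero => exact ⟨0, f, by simp⟩
  | succ k ih =>
    obtain ⟨l, s, hs⟩ := ih fun j hj => he j (by omega)
    have hroot : IsRoot (s - C (s.eval c / (e k).eval c) * e k) c := by
      simp [he k (by omega)]
    obtain ⟨s', hs'⟩ := dvd_iff_isRoot.mpr hroot
    refine ⟨Function.update l k (s.eval c / (e k).eval c), s', ?_⟩
    rw [Finset.sum_range_succ, Function.update_self]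
    rw [Finset.sum_congr rfl (g := fun j => C (l j) * (X - C c) ^ j * e j) fun j hj => by
      rw [Function.update_of_ne (Finset.mem_range.mp hj).ne]]
    linear_combination hs + (X - C c) ^ k * hs'

/-- Split (x-c)^k as (x-c)^j (x-c)^(k-j): one factor completes the weight, the other joins f, whose
degree is then below n-j. -/
theorem integralBilin_X_sub_C_pow_mul_eq_zero {c : ℝ} {j k n : ℕ} {P : ℕ → ℝ[X]}
    (hP : IsOrthonormalPolynomials (fun f g => christoffelBilin hμ c j f g) P) (hjk : j ≤ k)
    {f : ℝ[X]} (hf : (k : WithBot ℕ) + f.degree < (n : ℕ)) (hjn : j ≤ n) :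
    integralBilin μ hμ ((X - C c) ^ k * f) ((X - C c) ^ j * P (n - j)) = 0 := by
  have h1 := hP.apply_eq_zero (n := n - j) (f := (X - C c) ^ (k - j) * f) (by
    rw [degree_X_sub_C_pow_mul]
    rcases eq_or_ne f 0 with rfl | h0
    · simp
    rw [degree_eq_natDegree h0] at hf ⊢
    norm_cast at hf ⊢
    omega)
  rwa [christoffelBilin_apply, ← mul_assoc, ← pow_add, Nat.add_sub_cancel' hjk] at h1

theorem exists_connection_formula (hinf : μ.support.Infinite) {c : ℝ} (hc : ∀ᵐ x ∂μ, c ≤ x)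
    {r : ℕ} {M : ℕ → ℝ} {p : ℕ → ℕ → ℝ[X]} {q : ℕ → ℝ[X]}
    (hp : ∀ j ≤ r + 1, IsOrthonormalPolynomials (fun f g => christoffelBilin hμ c j f g) (p j))
    (hq : IsOrthonormalPolynomials (fun f g => sobolevBilin hμ c r M f g) q)
    {n : ℕ} (hn : r + 1 ≤ n) :
    ∃ l : ℕ → ℝ,
      q n = ∑ j ∈ Finset.range (r + 2), C (l j) * (X - C c) ^ j * p j (n - j) := by
  obtain ⟨l, s, hs⟩ := exists_triangular_expansion (c := c) (e := fun j => p j (n - j)) (k := r + 1)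
    (fun j hj => (hp j hj.le).eval_ne_zero hμ hinf hc _) (q n)
  have hs' : (X - C c) ^ (r + 1) * s =
      q n - ∑ j ∈ Finset.range (r + 1), l j • ((X - C c) ^ j * p j (n - j)) := by
    rw [eq_sub_iff_add_eq']
    simp only [smul_eq_C_mul, ← mul_assoc]
    exact hs.symm
  have hdeg : s.degree < (n - (r + 1) + 1 : ℕ) := by
    have h1 : ((X - C c) ^ (r + 1) * s).degree < ((n + 1 : ℕ) : WithBot ℕ) := by
      rw [hs', ← mem_degreeLT]
      refine Submodule.sub_mem _ ?_ (Submodule.sum_mem _ fun j hj => Submodule.smul_mem _ _ ?_)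
      · rw [mem_degreeLT, hq.degree_eq]
        exact_mod_cast n.lt_succ_self
      · have hj' := Finset.mem_range.mp hj
        rw [mem_degreeLT, degree_X_sub_C_pow_mul, (hp j hj'.le).degree_eq]
        norm_cast
        omega
    rw [degree_X_sub_C_pow_mul] at h1
    rcases eq_or_ne s 0 with rfl | h0
    · simp
    rw [degree_eq_natDegree h0] at h1 ⊢
    norm_cast at h1 ⊢
    omega
  -- Test against (x-c)^(r+1) `p (r+1) m`: its Taylor coefficients up to order r vanish, so the
  -- point masses do not see it, and it is orthogonal to q_n and to every subtracted term.
  have horth : ∀ m < n - (r + 1), christoffelBilin hμ c (r + 1) s (p (r + 1) m) = 0 := by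
    intro m hm
    have hd : ((r + 1 : ℕ) : WithBot ℕ) + (p (r + 1) m).degree < (n : ℕ) := by
      rw [(hp (r + 1) le_rfl).degree_eq]
      norm_cast
      omega
    have h1 : integralBilin μ hμ ((X - C c) ^ (r + 1) * p (r + 1) m) (q n) = 0 := by
      have h2 := hq.apply_eq_zero (n := n) (f := (X - C c) ^ (r + 1) * p (r + 1) m)
        (by rwa [degree_X_sub_C_pow_mul])
      rw [sobolevBilin_apply, Finset.sum_eq_zero, add_zero] at h2
      · exact h2
      · intro i _
        rw [coeff_taylor_X_sub_C_pow_mul, if_neg (by omega)]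
        ring
    rw [christoffelBilin_apply, hs', integralBilin_comm, map_sub, h1, map_sum,
      Finset.sum_eq_zero, sub_zero]
    intro j hj
    have hj' := Finset.mem_range.mp hj
    rw [map_smul, integralBilin_X_sub_C_pow_mul_eq_zero hμ (hp j hj'.le) hj'.le hd (by omega),
      smul_zero]
  have h3 := (hp (r + 1) le_rfl).eq_smul hdeg horth
  refine ⟨Function.update l (r + 1)
    (christoffelBilin hμ c (r + 1) s (p (r + 1) (n - (r + 1)))), ?_⟩
  rw [Finset.sum_range_succ, Function.update_self]
  rw [Finset.sum_congr rfl (g := fun j => C (l j) * (X - C c) ^ j * p j (n - j)) fun j hj => by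
    rw [Function.update_of_ne (Finset.mem_range.mp hj).ne]]
  conv_lhs => rw [hs, h3, smul_eq_C_mul]
  ring

end Connection

/-! ### Asymptotics of sums and of quadratic forms -/

/-- This is the difference quotient of y^(s+1) at y = 1 with step 1/m. -/
theorem tendsto_rpow_add_one_sub_rpow_div (s : ℝ) :
    Tendsto (fun m : ℕ => (((m : ℝ) + 1) ^ (s + 1) - (m : ℝ) ^ (s + 1)) / (m : ℝ) ^ s) atTop
      (𝓝 (s + 1)) := by
  have h1 : HasDerivAt (fun y : ℝ => y ^ (s + 1)) (s + 1) 1 := by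
    simpa using Real.hasDerivAt_rpow_const (x := 1) (p := s + 1) (Or.inl one_ne_zero)
  have h2 : Tendsto (fun m : ℕ => ((m : ℝ))⁻¹) atTop (𝓝[≠] 0) := by
    refine tendsto_nhdsWithin_iff.mpr ⟨tendsto_natCast_atTop_atTop.inv_tendsto_atTop, ?_⟩
    filter_upwards [eventually_gt_atTop 0] with m hm
    simpa using hm.ne'
  refine ((hasDerivAt_iff_tendsto_slope_zero.mp h1).comp h2).congr' ?_
  filter_upwards [eventually_gt_atTop 0] with m hm
  have hm' : (0 : ℝ) < m := by exact_mod_cast hm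
  have h3 : (1 : ℝ) + (m : ℝ)⁻¹ = (m + 1) / m := by field_simp
  simp only [Function.comp_apply, inv_inv, smul_eq_mul, Real.one_rpow]
  rw [h3, Real.div_rpow (by positivity) hm'.le, Real.rpow_add_one hm'.ne' s]
  have := (Real.rpow_pos_of_pos hm' s).ne'
  field_simp

/-- Stolz–Cesàro: m^s is replaced by the telescoping weights (m+1)^(s+1) - m^(s+1), whose partial
sums are exactly n^(s+1). -/
theorem tendsto_sum_range_div_rpow {x : ℕ → ℝ} {s L : ℝ} (hs : -1 < s)
    (h : Tendsto (fun m : ℕ => x m / (m : ℝ) ^ s) atTop (𝓝 L)) :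
    Tendsto (fun n : ℕ => (∑ m ∈ Finset.range n, x m) / (n : ℝ) ^ (s + 1)) atTop
      (𝓝 (L / (s + 1))) := by
  have hs1 : 0 < s + 1 := by linarith
  set g : ℕ → ℝ := fun m => ((m : ℝ) + 1) ^ (s + 1) - (m : ℝ) ^ (s + 1) with hg
  have hgpos : ∀ m, 0 < g m := fun m =>
    sub_pos.mpr (Real.rpow_lt_rpow m.cast_nonneg (by linarith) hs1)
  have hsum : ∀ n : ℕ, ∑ m ∈ Finset.range n, g m = (n : ℝ) ^ (s + 1) := by
    intro n
    have := Finset.sum_range_sub (fun m : ℕ => (m : ℝ) ^ (s + 1)) n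
    simpa [hg, Real.zero_rpow hs1.ne'] using this
  have hxg : Tendsto (fun m => x m / g m) atTop (𝓝 (L / (s + 1))) := by
    refine (h.div (tendsto_rpow_add_one_sub_rpow_div s) hs1.ne').congr' ?_
    filter_upwards [eventually_gt_atTop 0] with m hm
    have := (Real.rpow_pos_of_pos (by exact_mod_cast hm : (0 : ℝ) < m) s).ne'
    have := (hgpos m).ne'
    simp only [Pi.div_apply]
    change x m / _ / (g m / _) = _
    field_simp
  have hlo : (fun m => x m - L / (s + 1) * g m) =o[atTop] g := by
    rw [Asymptotics.isLittleO_iff_tendsto' (Eventually.of_forall fun m hm =>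
      absurd hm (hgpos m).ne')]
    have := hxg.sub_const (L / (s + 1))
    rw [sub_self] at this
    refine this.congr fun m => ?_
    have := (hgpos m).ne'
    field_simp
  have htop : Tendsto (fun n : ℕ => (n : ℝ) ^ (s + 1)) atTop atTop :=
    (tendsto_rpow_atTop hs1).comp tendsto_natCast_atTop_atTop
  have h2 := (hlo.sum_range (fun m => (hgpos m).le) (by simpa only [hsum] using htop))
  simp only [Finset.sum_sub_distrib, ← Finset.mul_sum, hsum] at h2
  have h3 := h2.tendsto_div_nhds_zero.add_const (L / (s + 1))
  rw [zero_add] at h3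
  refine h3.congr' ?_
  filter_upwards [eventually_gt_atTop 0] with n hn
  have := (Real.rpow_pos_of_pos (by exact_mod_cast hn : (0 : ℝ) < n) (s + 1)).ne'
  field_simp
  ring

/-- The Cauchy matrix `1 / (ν + 1 + i + j)` is positive definite. -/
theorem cauchy_quadratic_pos {ν : ℝ} (hν : -1 < ν) {m : ℕ} {x : Fin m → ℝ} (hx : x ≠ 0) :
    0 < ∑ i, ∑ j, x i * x j * (1 / (ν + 1 + i + j)) := by
  -- The quadratic form equals ∫₀¹ t^ν P(t)² dt, since 1/(ν+1+i+j) is the integral of t^(ν+i+j).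
  set P : ℝ[X] := ∑ i : Fin m, monomial (i : ℕ) (x i) with hP
  have hP0 : P ≠ 0 := by
    obtain ⟨i, hi⟩ := Function.ne_iff.mp hx
    intro h
    apply hi
    have := congrArg (fun f => f.coeff (i : ℕ)) h
    simpa [hP, finsetSum_coeff, coeff_monomial, Fin.val_inj] using this
  have hexp : ∀ t : ℝ, 0 < t → t ^ ν * P.eval t ^ 2 =
      ∑ i : Fin m, ∑ j : Fin m, x i * x j * t ^ (ν + i + j) := by
    intro t ht
    have he : P.eval t = ∑ i : Fin m, x i * t ^ (i : ℕ) := by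
      simp [hP, eval_finsetSum]
    rw [he, sq, Finset.sum_mul_sum, Finset.mul_sum]
    refine Finset.sum_congr rfl fun i _ => ?_
    rw [Finset.mul_sum]
    refine Finset.sum_congr rfl fun j _ => ?_
    rw [Real.rpow_add ht, Real.rpow_add ht, Real.rpow_natCast, Real.rpow_natCast]
    ring
  have hexpo : ∀ i j : Fin m, -1 < ν + (i : ℕ) + (j : ℕ) := fun i j => by
    have h1 : (0 : ℝ) ≤ (i : ℕ) := Nat.cast_nonneg _
    have h2 : (0 : ℝ) ≤ (j : ℕ) := Nat.cast_nonneg _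
    linarith
  have hint : ∀ i j : Fin m, IntervalIntegrable
      (fun t : ℝ => x i * x j * t ^ (ν + (i : ℕ) + (j : ℕ))) volume 0 1 := fun i j =>
    (intervalIntegral.intervalIntegrable_rpow' (hexpo i j)).const_mul _
  have hI : ∫ t in (0 : ℝ)..1, (∑ i : Fin m, ∑ j : Fin m, x i * x j * t ^ (ν + i + j)) =
      ∑ i, ∑ j, x i * x j * (1 / (ν + 1 + i + j)) := by
    rw [intervalIntegral.integral_finsetSum fun i _ => by
      simpa only [Finset.sum_fn] using IntervalIntegrable.sum Finset.univ fun j _ => hint i j]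
    refine Finset.sum_congr rfl fun i _ => ?_
    rw [intervalIntegral.integral_finsetSum fun j _ => hint i j]
    refine Finset.sum_congr rfl fun j _ => ?_
    rw [intervalIntegral.integral_const_mul, integral_rpow (Or.inl (hexpo i j)), Real.one_rpow,
      Real.zero_rpow (by linarith [hexpo i j])]
    congr 2
    · ring
    · ring
  have hint' : IntervalIntegrable
      (fun t : ℝ => ∑ i : Fin m, ∑ j : Fin m, x i * x j * t ^ (ν + i + j)) volume 0 1 := by
    have := IntervalIntegrable.sum Finset.univ fun i _ =>
      IntervalIntegrable.sum Finset.univ fun j _ => hint i j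
    simpa only [Finset.sum_fn] using this
  rw [← hI]
  have hnn : 0 ≤ᵐ[volume.restrict (Set.Ioc (0 : ℝ) 1)]
      fun t => ∑ i : Fin m, ∑ j : Fin m, x i * x j * t ^ (ν + i + j) := by
    filter_upwards [ae_restrict_mem measurableSet_Ioc] with t ht
    simp only [Pi.zero_apply, ← hexp t ht.1]
    have := Real.rpow_nonneg ht.1.le ν
    positivity
  rw [intervalIntegral.integral_of_le zero_le_one]
  refine lt_of_le_of_ne (integral_nonneg_of_ae hnn) fun h0 => ?_
  rw [eq_comm, integral_eq_zero_iff_of_nonneg_ae hnn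
    ((intervalIntegrable_iff_integrableOn_Ioc_of_le zero_le_one).mp hint')] at h0
  -- A zero integral would make P vanish almost everywhere on (0,1], but its roots form a null set.
  have hroots : ∀ᵐ t ∂(volume.restrict (Set.Ioc (0 : ℝ) 1)), t ∉ (P.roots.toFinset : Set ℝ) :=
    ae_restrict_of_ae (P.roots.toFinset.finite_toSet.countable.ae_notMem volume)
  have hne : NeBot (ae (volume.restrict (Set.Ioc (0 : ℝ) 1))) := by
    rw [ae_neBot, Ne, Measure.restrict_eq_zero]
    simp
  obtain ⟨t, h1, h2, h3⟩ :=
    (h0.and (hroots.and (ae_restrict_mem measurableSet_Ioc))).exists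
  change ∑ i : Fin m, ∑ j : Fin m, x i * x j * t ^ (ν + i + j) = 0 at h1
  rw [← hexp t h3.1] at h1
  have h4 := (Real.rpow_pos_of_pos h3.1 ν).ne'
  have h5 : P.eval t = 0 := by simpa [h4] using h1
  apply h2
  simpa [hP0] using h5

/-- Compactness of the unit sphere gives a margin δ for the limit form; entrywise convergence
eventually costs at most half of it, uniformly in x. -/
theorem eventually_quadratic_lower_bound {ι : Type*} [Fintype ι] {G : ℕ → ι → ι → ℝ}
    {H : ι → ι → ℝ} (hG : ∀ i j, Tendsto (fun n => G n i j) atTop (𝓝 (H i j)))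
    (hH : ∀ x : ι → ℝ, x ≠ 0 → 0 < ∑ i, ∑ j, x i * x j * H i j) :
    ∃ δ > 0, ∀ᶠ n in atTop, ∀ x : ι → ℝ, δ * ‖x‖ ^ 2 ≤ ∑ i, ∑ j, x i * x j * G n i j := by
  obtain ⟨δ, hδ, hbound⟩ : ∃ δ > 0, ∀ x : ι → ℝ, δ * ‖x‖ ^ 2 ≤ ∑ i, ∑ j, x i * x j * H i j := by
    have hcont : Continuous fun x : ι → ℝ => ∑ i, ∑ j, x i * x j * H i j := by fun_prop
    rcases (Metric.sphere (0 : ι → ℝ) 1).eq_empty_or_nonempty with he | hne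
    -- An empty sphere means the space is zero, so any constant works.
    · refine ⟨1, one_pos, fun x => ?_⟩
      have hx : x = 0 := by
        by_contra hx
        have : ‖x‖⁻¹ • x ∈ Metric.sphere (0 : ι → ℝ) 1 := by
          simp [norm_smul, hx]
        simp [he] at this
      simp [hx]
    · obtain ⟨y, hy, hmin⟩ := (isCompact_sphere (0 : ι → ℝ) 1).exists_isMinOn hne hcont.continuousOn
      have hy1 : ‖y‖ = 1 := by simpa using hy
      refine ⟨_, hH y (by rintro rfl; simp at hy1), fun x => ?_⟩
      rcases eq_or_ne x 0 with rfl | hx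
      · simp
      have hx' : ‖x‖ ≠ 0 := by simpa using hx
      have h1 := hmin (a := ‖x‖⁻¹ • x) (by simp [norm_smul, hx])
      simp only [Set.mem_ofPred_eq, Pi.smul_apply, smul_eq_mul] at h1
      calc _ ≤ (∑ i, ∑ j, ‖x‖⁻¹ * x i * (‖x‖⁻¹ * x j) * H i j) * ‖x‖ ^ 2 := by gcongr
        _ = _ := by
          simp only [Finset.sum_mul]
          refine Finset.sum_congr rfl fun i _ => Finset.sum_congr rfl fun j _ => ?_
          field_simp
  refine ⟨δ / 2, by positivity, ?_⟩
  have hdiff : Tendsto (fun n => ∑ i, ∑ j, |G n i j - H i j|) atTop (𝓝 0) := by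
    have : Tendsto (fun n => ∑ i, ∑ j, |G n i j - H i j|) atTop
        (𝓝 (∑ i, ∑ j, |H i j - H i j|)) :=
      tendsto_finsetSum _ fun i _ => tendsto_finsetSum _ fun j _ => ((hG i j).sub_const _).abs
    simpa using this
  filter_upwards [hdiff.eventually (gt_mem_nhds (half_pos hδ))] with n hn x
  have h2 : ∑ i, ∑ j, x i * x j * H i j - ∑ i, ∑ j, x i * x j * G n i j ≤
      (∑ i, ∑ j, |G n i j - H i j|) * ‖x‖ ^ 2 := by
    simp only [← Finset.sum_sub_distrib, Finset.sum_mul]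
    refine Finset.sum_le_sum fun i _ => Finset.sum_le_sum fun j _ => ?_
    calc x i * x j * H i j - x i * x j * G n i j = -(x i * x j * (G n i j - H i j)) := by ring
      _ ≤ |x i * x j * (G n i j - H i j)| := neg_le_abs _
      _ = |x i| * |x j| * |G n i j - H i j| := by rw [abs_mul, abs_mul]
      _ ≤ ‖x‖ * ‖x‖ * |G n i j - H i j| := by
        gcongr
        · exact norm_le_pi_norm x i
        · exact norm_le_pi_norm x j
      _ = _ := by ring
  nlinarith [hbound x, sq_nonneg ‖x‖]

/-! ### Locally uniform convergence -/

/-- Joint convergence in (n, z) allows the argument to move with n, as the rescaling of the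
connection terms requires. -/
theorem TendstoUniformlyOnCompacts.tendsto_prod {F : ℕ → ℂ → ℂ} {f : ℂ → ℂ}
    (h : TendstoUniformlyOnCompacts F f) (hF : ∀ n, Continuous (F n)) (x : ℂ) :
    Tendsto (fun y : ℕ × ℂ => F y.1 y.2) (atTop ×ˢ 𝓝 x) (𝓝 (f x)) := by
  have h1 : TendstoLocallyUniformly F f atTop :=
    tendstoLocallyUniformly_iff_forall_isCompact.mpr h
  have hf : Continuous f := h1.continuous (Frequently.of_forall hF)
  have h2 := tendstoLocallyUniformly_iff_forall_tendsto.mp h1 x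
  have h3 : Tendsto (fun y : ℕ × ℂ => f y.2) (atTop ×ˢ 𝓝 x) (𝓝 (f x)) :=
    hf.continuousAt.tendsto.comp tendsto_snd
  exact h3.congr_uniformity h2

theorem TendstoUniformlyOnCompacts.continuous {F : ℕ → ℂ → ℂ} {f : ℂ → ℂ}
    (h : TendstoUniformlyOnCompacts F f) (hF : ∀ n, Continuous (F n)) : Continuous f :=
  (tendstoLocallyUniformly_iff_forall_isCompact.mpr h).continuous (Frequently.of_forall hF)

theorem TendstoUniformlyOnCompacts.of_tendsto_prod {F : ℕ → ℂ → ℂ} {f : ℂ → ℂ}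
    (hf : Continuous f)
    (h : ∀ x, Tendsto (fun y : ℕ × ℂ => F y.1 y.2) (atTop ×ˢ 𝓝 x) (𝓝 (f x))) :
    TendstoUniformlyOnCompacts F f := by
  refine tendstoLocallyUniformly_iff_forall_isCompact.mp
    (tendstoLocallyUniformly_iff_forall_tendsto.mpr fun x => ?_)
  have h3 : Tendsto (fun y : ℕ × ℂ => f y.2) (atTop ×ˢ 𝓝 x) (𝓝 (f x)) :=
    hf.continuousAt.tendsto.comp tendsto_snd
  exact (h3.prodMk_nhds (h x)).mono_right (nhds_le_uniformity (f x))

/-! ### Taylor coefficients from Mehler–Heine asymptotics -/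

open scoped NNReal in
/-- Cauchy's estimate for the coefficients of a power series. -/
theorem norm_coeff_le_of_forall_norm_eq_one {d : ℕ → ℂ} {R : ℝ≥0} (hR : 1 < R)
    (hd : Summable fun k => ‖d k‖ * (R : ℝ) ^ k) {ε : ℝ}
    (h : ∀ w : ℂ, ‖w‖ = 1 → ‖∑' k, d k * w ^ k‖ ≤ ε) (k : ℕ) : ‖d k‖ ≤ ε := by
  set p := FormalMultilinearSeries.ofScalars ℂ d with hp
  have hrad : (R : ENNReal) ≤ p.radius :=
    -- A radius beyond 1 makes the sum holomorphic on a neighbourhood of the closed unit disc.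
    p.le_radius_of_summable (by simpa [hp, FormalMultilinearSeries.ofScalars_norm] using hd)
  have h1R : (1 : ENNReal) < R := by exact_mod_cast hR
  have hball := p.hasFPowerSeriesOnBall (lt_of_lt_of_le (by simp; linarith) hrad)
  have hsum : p.sum = fun w => ∑' k, d k * w ^ k := by
    have := FormalMultilinearSeries.ofScalarsSum_eq_tsum (E := ℂ) d
    simp only [smul_eq_mul] at this
    exact this
  have hdiff : DiffContOnCl ℂ p.sum (Metric.ball 0 1) := by
    refine DifferentiableOn.diffContOnCl (hball.differentiableOn.mono ?_)
    rw [closure_ball _ one_ne_zero]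
    intro x hx
    rw [Metric.mem_eball, edist_zero_right]
    refine lt_of_le_of_lt ?_ (h1R.trans_le hrad)
    rw [mem_closedBall_zero_iff] at hx
    rw [← ofReal_norm, ← ENNReal.ofReal_one]
    exact ENNReal.ofReal_le_ofReal hx
  have h1 := Complex.norm_iteratedDeriv_le_of_forall_mem_sphere_norm_le (C := ε) k one_pos hdiff
    (fun z hz => by rw [hsum]; exact h z (by simpa using hz))
  have h2 := hball.factorial_smul 1 k
  rw [← iteratedDeriv_eq_iteratedFDeriv, hp, FormalMultilinearSeries.ofScalars_apply_eq, ← hp] at h2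
  rw [← h2] at h1
  have hk : (0 : ℝ) < k.factorial := by exact_mod_cast k.factorial_pos
  simp only [one_pow, smul_eq_mul, mul_one, div_one, nsmul_eq_mul, norm_mul,
    Complex.norm_natCast] at h1
  exact le_of_mul_le_mul_left h1 hk

/-- The power series coefficients of `z^{-τ} J_τ(2z)` in the variable `z²`. -/
noncomputable def besselCoeff (τ : ℝ) (k : ℕ) : ℝ :=
  (-1) ^ k / (k.factorial * Real.Gamma (k + τ + 1))

theorem besselCoeff_ne_zero {τ : ℝ} (hτ : -1 < τ) (k : ℕ) : besselCoeff τ k ≠ 0 := by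
  have hp : 0 < Real.Gamma (k + τ + 1) :=
    Real.Gamma_pos_of_pos (by have : (0 : ℝ) ≤ k := k.cast_nonneg; linarith)
  have : (0 : ℝ) < k.factorial := by exact_mod_cast k.factorial_pos
  exact div_ne_zero (pow_ne_zero _ (by norm_num)) (by positivity)

theorem summable_norm_besselCoeff {τ : ℝ} (hτ : -1 < τ) :
    Summable fun k => ‖besselCoeff τ k‖ * (4 : ℝ) ^ k := by
  refine (besselJ_coeff_summable hτ 2).congr fun k => ?_
  have hp : 0 < Real.Gamma (k + τ + 1) :=
    Real.Gamma_pos_of_pos (by have : (0 : ℝ) ≤ k := k.cast_nonneg; linarith)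
  rw [besselCoeff, norm_div, norm_mul, norm_pow, norm_neg, norm_one, one_pow, one_div,
    Real.norm_natCast, Real.norm_of_nonneg hp.le, pow_mul]
  norm_num

theorem besselQuot_self_eq {τ : ℝ} (hτ : -1 < τ) (z : ℂ) :
    besselQuot τ τ z = ∑' k, (besselCoeff τ k : ℂ) * (z ^ 2) ^ k := by
  rw [besselQuot_eq (m := 0) hτ (by simp), mul_zero, pow_zero, one_mul]
  refine tsum_congr fun k => ?_
  rw [besselCoeff, pow_mul]
  push_cast
  rfl

theorem hasSum_aeval_add (c : ℝ) (f : ℝ[X]) (y : ℂ) :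
    HasSum (fun k => ((taylor c f).coeff k : ℂ) * y ^ k) (aeval ((c : ℂ) + y) f) := by
  have h1 : aeval ((c : ℂ) + y) f = aeval y (taylor c f) := by
    rw [taylor_apply, aeval_comp]
    simp [add_comm]
  rw [h1, aeval_eq_sum_range]
  simp only [Algebra.smul_def, Complex.coe_algebraMap]
  refine hasSum_sum_of_ne_finset_zero fun k hk => ?_
  rw [coeff_eq_zero_of_natDegree_lt (by simpa using hk)]
  simp

/-- In the variable w = z² both sides are power series. Uniform closeness on the unit circle passes
to every coefficient by Cauchy's estimate. -/
theorem tendsto_taylor_coeff_of_mehlerHeine {c σ : ℝ} (hσ : -1 < σ) {s β : ℕ → ℝ}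
    {P : ℕ → ℝ[X]}
    (h : TendstoUniformlyOnCompacts
      (fun n z => (s n : ℂ) * aeval ((c : ℂ) + z ^ 2 / (β n : ℂ)) (P n)) (besselQuot σ σ))
    (k : ℕ) :
    Tendsto (fun n => s n * (taylor c (P n)).coeff k / β n ^ k) atTop (𝓝 (besselCoeff σ k)) := by
  rw [Metric.tendsto_nhds]
  intro ε hε
  have h1 := Metric.tendstoUniformlyOn_iff.mp (h _ (isCompact_sphere (0 : ℂ) 1)) (ε / 2)
    (half_pos hε)
  filter_upwards [h1] with n hn
  refine lt_of_le_of_lt ?_ (half_lt_self hε)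
  set t : ℕ → ℝ := fun k => s n * (taylor c (P n)).coeff k / β n ^ k with ht
  have htS : Summable fun k => ‖t k‖ * (4 : ℝ) ^ k := by
    refine summable_of_ne_finset_zero (s := Finset.range ((taylor c (P n)).natDegree + 1))
      fun k hk => ?_
    simp only [ht]
    rw [coeff_eq_zero_of_natDegree_lt (by simpa using hk)]
    simp
  have hdS : Summable fun k => ‖((t k - besselCoeff σ k : ℝ) : ℂ)‖ * ((4 : NNReal) : ℝ) ^ k := by
    refine Summable.of_nonneg_of_le (fun k => by positivity) (fun k => ?_)
      (htS.add (summable_norm_besselCoeff hσ))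
    rw [Complex.norm_real, ← add_mul]
    gcongr
    · exact norm_sub_le _ _
    · norm_num
  have := norm_coeff_le_of_forall_norm_eq_one (R := 4) (by norm_num) hdS (ε := ε / 2) ?_ k
  · rwa [Complex.norm_real] at this
  · intro w hw
    -- Every w on the unit circle is z² with |z| = 1, so the hypothesis in z covers the whole circle
    -- in w.
    obtain ⟨z, hz⟩ := IsAlgClosed.exists_pow_nat_eq w (n := 2) (by norm_num)
    have hz1 : ‖z‖ = 1 := by
      have : ‖z‖ ^ 2 = 1 := by rw [← norm_pow, hz, hw]
      exact (pow_eq_one_iff_of_nonneg (norm_nonneg _) two_ne_zero).mp this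
    have h2 := hn z (by simpa using hz1)
    have hs1 : HasSum (fun k => (t k : ℂ) * w ^ k)
        ((s n : ℂ) * aeval ((c : ℂ) + z ^ 2 / (β n : ℂ)) (P n)) := by
      have hterm : (fun k => (t k : ℂ) * w ^ k) = fun k =>
          (s n : ℂ) * (((taylor c (P n)).coeff k : ℂ) * (z ^ 2 / (β n : ℂ)) ^ k) := by
        funext k
        simp only [ht]
        push_cast
        rw [hz, div_pow]
        ring
      rw [hterm]
      exact (hasSum_aeval_add c (P n) (z ^ 2 / (β n : ℂ))).mul_left (s n : ℂ)
    have hs2 : HasSum (fun k => (besselCoeff σ k : ℂ) * w ^ k) (besselQuot σ σ z) := by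
      rw [besselQuot_self_eq hσ, hz]
      refine Summable.hasSum (Summable.of_norm ?_)
      refine Summable.of_nonneg_of_le (fun k => norm_nonneg _) (fun k => ?_)
        (summable_norm_besselCoeff hσ)
      rw [norm_mul, norm_pow, hw, Complex.norm_real]
      gcongr
      norm_num
    have hs3 := hs1.sub hs2
    simp only [← sub_mul, ← Complex.ofReal_sub] at hs3
    rw [hs3.tsum_eq, ← dist_eq_norm, dist_comm]
    exact h2.le

/-! ### Derivatives of the Sobolev polynomials at `c` -/

section Sobolev

variable {μ : Measure ℝ} (hμ : ∀ n : ℕ, Integrable (fun x : ℝ => x ^ n) μ)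
  {c : ℝ} {r : ℕ} {M : ℕ → ℝ} {P q : ℕ → ℝ[X]}

theorem sobolev_integralBilin_self_le_one (hM : ∀ i ≤ r, 0 < M i)
    (hq : IsOrthonormalPolynomials (fun f g => sobolevBilin hμ c r M f g) q) (n : ℕ) :
    integralBilin μ hμ (q n) (q n) ≤ 1 := by
  have h1 := hq.orthonormal n n
  simp only [if_true, sobolevBilin_apply] at h1
  have h2 : 0 ≤ ∑ i : Fin (r + 1), (M i * (i : ℕ).factorial ^ 2) * (taylor c (q n)).coeff i *
      (taylor c (q n)).coeff i := by
    refine Finset.sum_nonneg fun i _ => ?_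
    have := hM i (by omega)
    rw [mul_assoc]
    exact mul_nonneg (by positivity) (mul_self_nonneg _)
  linarith

theorem sobolev_connection_pos
    (hP : IsOrthonormalPolynomials (fun f g => integralBilin μ hμ f g) P)
    (hq : IsOrthonormalPolynomials (fun f g => sobolevBilin hμ c r M f g) q)
    (n : ℕ) : 0 < integralBilin μ hμ (q n) (P n) := by
  rw [hP.apply_eq_div (by rw [hq.degree_eq]; exact_mod_cast n.lt_succ_self)]
  exact div_pos (hq.coeff_pos n) (hP.coeff_pos n)

/-- The two factors are the ratios of leading coefficients of q_n to P_n and of P_n to q_n; the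
second is the Sobolev product of q_n and P_n. -/
theorem sobolev_connection_mul
    (hP : IsOrthonormalPolynomials (fun f g => integralBilin μ hμ f g) P)
    (hq : IsOrthonormalPolynomials (fun f g => sobolevBilin hμ c r M f g) q)
    (n : ℕ) :
    integralBilin μ hμ (q n) (P n) * (integralBilin μ hμ (q n) (P n) + ∑ i : Fin (r + 1),
      (M i * (i : ℕ).factorial ^ 2) * (taylor c (q n)).coeff i * (taylor c (P n)).coeff i) = 1 := by
  have h1 := hq.apply_eq_div (n := n) (f := P n)
    (by rw [hP.degree_eq]; exact_mod_cast n.lt_succ_self)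
  have h2 := hP.apply_eq_div (n := n) (f := q n)
    (by rw [hq.degree_eq]; exact_mod_cast n.lt_succ_self)
  rw [sobolevBilin_apply, integralBilin_comm] at h1
  have h3 : ∀ i : Fin (r + 1), (M i * (i : ℕ).factorial ^ 2) * (taylor c (q n)).coeff i *
      (taylor c (P n)).coeff i = (M i * (i : ℕ).factorial ^ 2) * (taylor c (P n)).coeff i *
      (taylor c (q n)).coeff i := fun i => by ring
  rw [Finset.sum_congr rfl fun i _ => h3 i, h1, h2]
  have := (hq.coeff_pos n).ne'
  have := (hP.coeff_pos n).ne'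
  field_simp

theorem sobolev_fourier_coeff
    (hP : IsOrthonormalPolynomials (fun f g => integralBilin μ hμ f g) P)
    (hq : IsOrthonormalPolynomials (fun f g => sobolevBilin hμ c r M f g) q)
    {m n : ℕ} (hmn : m < n) :
    integralBilin μ hμ (q n) (P m) = -∑ i : Fin (r + 1),
      (M i * (i : ℕ).factorial ^ 2) * (taylor c (q n)).coeff i * (taylor c (P m)).coeff i := by
  have h1 := hq.apply_eq_zero (n := n) (f := P m) (by rw [hP.degree_eq]; exact_mod_cast hmn)
  rw [sobolevBilin_apply, integralBilin_comm] at h1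
  rw [eq_neg_iff_add_eq_zero, ← h1]
  congr 1
  exact Finset.sum_congr rfl fun i _ => by ring

/-- Parseval gives κ² + Σ_{m<n} (…)² ≤ 1, while κ² + κη = 1; subtracting bounds the sum by κη. -/
theorem sobolev_energy
    (hP : IsOrthonormalPolynomials (fun f g => integralBilin μ hμ f g) P)
    (hq : IsOrthonormalPolynomials (fun f g => sobolevBilin hμ c r M f g) q)
    (hM : ∀ i ≤ r, 0 < M i) (n : ℕ) :
    integralBilin μ hμ (q n) (P n) ≤ 1 ∧
    ∑ m ∈ Finset.range n, (∑ i : Fin (r + 1), (M i * (i : ℕ).factorial ^ 2) *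
      (taylor c (q n)).coeff i * (taylor c (P m)).coeff i) ^ 2 ≤
    integralBilin μ hμ (q n) (P n) * ∑ i : Fin (r + 1), (M i * (i : ℕ).factorial ^ 2) *
      (taylor c (q n)).coeff i * (taylor c (P n)).coeff i := by
  have h1 := sobolev_integralBilin_self_le_one hμ hM hq n
  rw [hP.parseval (f := q n) (n := n + 1) (by rw [hq.degree_eq]; exact_mod_cast n.lt_succ_self),
    Finset.sum_range_succ, Finset.sum_congr rfl fun m hm => by
      rw [sobolev_fourier_coeff hμ hP hq (Finset.mem_range.mp hm), neg_sq]] at h1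
  have h2 := sobolev_connection_mul hμ hP hq n
  have h3 := sobolev_connection_pos hμ hP hq n
  constructor
  · have h4 : 0 ≤ ∑ m ∈ Finset.range n, (∑ i : Fin (r + 1), (M i * (i : ℕ).factorial ^ 2) *
      (taylor c (q n)).coeff i * (taylor c (P m)).coeff i) ^ 2 :=
      Finset.sum_nonneg fun _ _ => sq_nonneg _
    nlinarith
  · rw [mul_add, ← sq] at h2
    linarith

variable {a b ν : ℝ} {E : ℕ → ℝ}

/-- The signs (-1)^m cancel in products, and 2a+1 = b(ν+1) turns the summation exponent into
b(ν+1+i+j), the source of the Cauchy matrix. -/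
theorem tendsto_gram (hb : 0 < b) (hν : -1 < ν) (hab : 2 * a + 1 = b * (ν + 1))
    {P : ℕ → ℝ[X]} {i j : ℕ}
    (hi : Tendsto (fun n : ℕ => (-1) ^ n * (taylor c (P n)).coeff i / (n : ℝ) ^ (a + i * b)) atTop
      (𝓝 (E i)))
    (hj : Tendsto (fun n : ℕ => (-1) ^ n * (taylor c (P n)).coeff j / (n : ℝ) ^ (a + j * b)) atTop
      (𝓝 (E j))) :
    Tendsto (fun n : ℕ => (∑ m ∈ Finset.range n, (taylor c (P m)).coeff i * (taylor c (P m)).coeff j)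
      / ((n : ℝ) ^ (a + i * b) * (n : ℝ) ^ (a + j * b) * n)) atTop
      (𝓝 (E i * E j * (1 / (b * (ν + 1 + i + j))))) := by
  set s : ℝ := (a + i * b) + (a + j * b) with hs
  have hs1 : s + 1 = b * (ν + 1 + i + j) := by rw [hs]; linear_combination hab
  have hi0 : (0 : ℝ) ≤ i := i.cast_nonneg
  have hj0 : (0 : ℝ) ≤ j := j.cast_nonneg
  have hpos : 0 < s + 1 := by rw [hs1]; exact mul_pos hb (by linarith)
  have h1 : Tendsto (fun m : ℕ => (taylor c (P m)).coeff i * (taylor c (P m)).coeff j /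
      (m : ℝ) ^ s) atTop (𝓝 (E i * E j)) := by
    refine (hi.mul hj).congr' ?_
    filter_upwards [eventually_gt_atTop 0] with m hm
    have hm' : (0 : ℝ) < m := by exact_mod_cast hm
    have hsgn : ((-1 : ℝ) ^ m) * (-1) ^ m = 1 := by rw [← mul_pow]; norm_num
    rw [hs, Real.rpow_add hm' (a + i * b), div_mul_div_comm]
    congr 1
    linear_combination (taylor c (P m)).coeff i * (taylor c (P m)).coeff j * hsgn
  have h2 := tendsto_sum_range_div_rpow (by linarith) h1
  rw [hs1, div_eq_mul_one_div] at h2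
  refine h2.congr' ?_
  filter_upwards [eventually_gt_atTop 0] with n hn
  have hn' : (0 : ℝ) < n := by exact_mod_cast hn
  rw [← hs1, Real.rpow_add_one hn'.ne', hs, Real.rpow_add hn' (a + i * b)]

theorem exists_scaled_sobolev_bound
    (hP : IsOrthonormalPolynomials (fun f g => integralBilin μ hμ f g) P)
    (hq : IsOrthonormalPolynomials (fun f g => sobolevBilin hμ c r M f g) q)
    (hM : ∀ i ≤ r, 0 < M i) (hb : 0 < b) (hν : -1 < ν)
    (hab : 2 * a + 1 = b * (ν + 1)) (hE : ∀ k ≤ r, E k ≠ 0)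
    (hv : ∀ k ≤ r, Tendsto
      (fun n : ℕ => (-1) ^ n * (taylor c (P n)).coeff k / (n : ℝ) ^ (a + k * b)) atTop (𝓝 (E k))) :
    ∃ K : ℝ, ∀ᶠ n : ℕ in atTop,
      (∀ i : Fin (r + 1), |(M i * (i : ℕ).factorial ^ 2) * (taylor c (q n)).coeff i *
        (n : ℝ) ^ (a + i * b)| ≤ K / n) ∧
      |∑ i : Fin (r + 1), (M i * (i : ℕ).factorial ^ 2) * (taylor c (q n)).coeff i *
        (taylor c (P n)).coeff i| ≤ K / n := by
  obtain ⟨δ, hδ, hlow⟩ := eventually_quadratic_lower_bound (ι := Fin (r + 1))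
    (fun i j => tendsto_gram hb hν hab (hv i (by omega)) (hv j (by omega)))
    (fun x hx => by
      -- The factors E_i are absorbed into the vector; being nonzero, they keep it nonzero.
      have h1 := cauchy_quadratic_pos hν (x := fun i : Fin (r + 1) => E i * x i) (by
        obtain ⟨i, hi⟩ := Function.ne_iff.mp hx
        exact Function.ne_iff.mpr ⟨i, mul_ne_zero (hE i (by omega)) hi⟩)
      have h2 := div_pos h1 hb
      rw [Finset.sum_div] at h2
      refine h2.trans_eq (Finset.sum_congr rfl fun i _ => ?_)
      rw [Finset.sum_div]
      refine Finset.sum_congr rfl fun j _ => ?_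
      have hi0 : (0 : ℝ) ≤ (i : ℕ) := Nat.cast_nonneg _
      have hj0 : (0 : ℝ) ≤ (j : ℕ) := Nat.cast_nonneg _
      have : ν + 1 + (i : ℕ) + (j : ℕ) ≠ 0 := by linarith
      field_simp)
  set D : ℝ := (∑ i : Fin (r + 1), |E i|) + 1 with hD
  have hD0 : 0 < D := by positivity
  have hvsum : ∀ᶠ n : ℕ in atTop, ∑ i : Fin (r + 1),
      |(-1) ^ n * (taylor c (P n)).coeff i / (n : ℝ) ^ (a + i * b)| < D := by
    have : Tendsto (fun n : ℕ => ∑ i : Fin (r + 1),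
        |(-1) ^ n * (taylor c (P n)).coeff i / (n : ℝ) ^ (a + i * b)|) atTop
        (𝓝 (∑ i : Fin (r + 1), |E i|)) :=
      tendsto_finsetSum _ fun i _ => (hv i (by omega)).abs
    exact this.eventually (gt_mem_nhds (by rw [hD]; linarith))
  -- The energy inequality yields ‖w‖ ≤ D/(δn), and |η| ≤ ‖w‖D; this constant dominates both D/δ and
  -- D²/δ.
  refine ⟨D / δ * (1 + D), ?_⟩
  filter_upwards [hlow, hvsum, eventually_gt_atTop 0] with n hn1 hn2 hn3
  have hn : (0 : ℝ) < n := by exact_mod_cast hn3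
  set u : Fin (r + 1) → ℝ := fun i => (M i * (i : ℕ).factorial ^ 2) * (taylor c (q n)).coeff i
    with hu
  have hS : ∀ i : ℕ, 0 < (n : ℝ) ^ (a + i * b) := fun i => Real.rpow_pos_of_pos hn _
  set w : Fin (r + 1) → ℝ := fun i => u i * (n : ℝ) ^ (a + (i : ℕ) * b) with hw
  have hη : |∑ i, u i * (taylor c (P n)).coeff i| ≤ ‖w‖ * D := by
    calc |∑ i, u i * (taylor c (P n)).coeff i|
        ≤ ∑ i, |u i * (taylor c (P n)).coeff i| := Finset.abs_sum_le_sum_abs _ _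
      _ ≤ ∑ i : Fin (r + 1),
          ‖w‖ * |(-1) ^ n * (taylor c (P n)).coeff i / (n : ℝ) ^ (a + i * b)| := by
          refine Finset.sum_le_sum fun i _ => ?_
          have h1 : |u i * (taylor c (P n)).coeff i| =
              |w i| * |(-1) ^ n * (taylor c (P n)).coeff i / (n : ℝ) ^ (a + i * b)| := by
            simp only [hw, abs_mul, abs_div, abs_pow, abs_neg, abs_one, one_pow, one_mul]
            have := (abs_pos.mpr (hS i).ne').ne'
            field_simp
          rw [h1]
          gcongr
          exact norm_le_pi_norm w i
      _ ≤ ‖w‖ * D := by rw [← Finset.mul_sum]; gcongr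
  obtain ⟨hκ1, hen⟩ := sobolev_energy hμ hP hq hM n
  have hκ0 := sobolev_connection_pos hμ hP hq n
  change ∑ m ∈ Finset.range n, (∑ i, u i * (taylor c (P m)).coeff i) ^ 2 ≤
    _ * ∑ i, u i * (taylor c (P n)).coeff i at hen
  have hquad : ∑ i : Fin (r + 1), ∑ j : Fin (r + 1), w i * w j *
      ((∑ m ∈ Finset.range n, (taylor c (P m)).coeff i * (taylor c (P m)).coeff j)
        / ((n : ℝ) ^ (a + i * b) * (n : ℝ) ^ (a + j * b) * n)) =
      (∑ m ∈ Finset.range n, (∑ i, u i * (taylor c (P m)).coeff i) ^ 2) / n := by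
    simp only [sq, Finset.sum_mul_sum]
    rw [Finset.sum_comm (s := Finset.range n), Finset.sum_div]
    refine Finset.sum_congr rfl fun i _ => ?_
    rw [Finset.sum_comm (s := Finset.range n), Finset.sum_div]
    refine Finset.sum_congr rfl fun j _ => ?_
    have h1 := (hS i).ne'
    have h2 := (hS j).ne'
    simp only [hw, Finset.sum_div, Finset.mul_sum]
    refine Finset.sum_congr rfl fun m _ => ?_
    field_simp
  have hle := hn1 w
  rw [hquad] at hle
  have hwn : ‖w‖ ≤ D / δ / n := by
    rcases (norm_nonneg w).eq_or_lt with h0 | h0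
    · rw [← h0]; positivity
    -- Gram lower bound, energy inequality, κ ≤ 1 and |η| ≤ ‖w‖D combined; one factor ‖w‖ then
    -- cancels.
    have h1 : δ * ‖w‖ ^ 2 ≤ ‖w‖ * D / n := by
      refine hle.trans ?_
      gcongr
      refine hen.trans ((mul_le_mul_of_nonneg_left (le_abs_self _) hκ0.le).trans ?_)
      refine (mul_le_of_le_one_left (abs_nonneg _) hκ1).trans hη
    rw [le_div_iff₀ hn] at h1
    rw [div_div, le_div_iff₀ (by positivity)]
    have : ‖w‖ * (‖w‖ * (δ * n)) ≤ ‖w‖ * D := by linarith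
    exact le_of_mul_le_mul_left this h0
  have hdn : 0 ≤ D / δ / n := by positivity
  constructor
  · intro i
    refine (norm_le_pi_norm w i).trans (hwn.trans ?_)
    rw [mul_div_right_comm]
    nlinarith
  · refine hη.trans ?_
    rw [mul_div_right_comm]
    nlinarith

theorem tendsto_sobolev_connection
    (hP : IsOrthonormalPolynomials (fun f g => integralBilin μ hμ f g) P)
    (hq : IsOrthonormalPolynomials (fun f g => sobolevBilin hμ c r M f g) q)
    (hM : ∀ i ≤ r, 0 < M i) (hb : 0 < b) (hν : -1 < ν)
    (hab : 2 * a + 1 = b * (ν + 1)) (hE : ∀ k ≤ r, E k ≠ 0)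
    (hv : ∀ k ≤ r, Tendsto
      (fun n : ℕ => (-1) ^ n * (taylor c (P n)).coeff k / (n : ℝ) ^ (a + k * b)) atTop (𝓝 (E k))) :
    Tendsto (fun n => integralBilin μ hμ (q n) (P n)) atTop (𝓝 1) := by
  obtain ⟨K, hK⟩ := exists_scaled_sobolev_bound hμ hP hq hM hb hν hab hE hv
  rw [tendsto_iff_dist_tendsto_zero]
  refine squeeze_zero' (Eventually.of_forall fun _ => dist_nonneg) ?_
    (tendsto_const_div_atTop_nhds_zero_nat K)
  filter_upwards [hK] with n hn
  obtain ⟨hκ1, -⟩ := sobolev_energy hμ hP hq hM n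
  have hκ0 := sobolev_connection_pos hμ hP hq n
  have h2 := sobolev_connection_mul hμ hP hq n
  rw [Real.dist_eq, abs_sub_comm, abs_of_nonneg (by linarith)]
  have h3 := (le_abs_self _).trans hn.2
  have h4 := (abs_nonneg _).trans hn.2
  -- Since 0 < κ ≤ 1, one has 1 - κ ≤ 1 - κ² = κη ≤ η.
  nlinarith

theorem tendsto_sobolev_taylor_coeff
    (hP : IsOrthonormalPolynomials (fun f g => integralBilin μ hμ f g) P)
    (hq : IsOrthonormalPolynomials (fun f g => sobolevBilin hμ c r M f g) q)
    (hM : ∀ i ≤ r, 0 < M i) (hb : 0 < b) (hν : -1 < ν)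
    (hab : 2 * a + 1 = b * (ν + 1)) (hE : ∀ k ≤ r, E k ≠ 0)
    (hv : ∀ k ≤ r, Tendsto
      (fun n : ℕ => (-1) ^ n * (taylor c (P n)).coeff k / (n : ℝ) ^ (a + k * b)) atTop (𝓝 (E k)))
    {k : ℕ} (hk : k ≤ r) :
    Tendsto (fun n : ℕ => (taylor c (q n)).coeff k / (n : ℝ) ^ (a + k * b)) atTop (𝓝 0) := by
  obtain ⟨K, hK⟩ := exists_scaled_sobolev_bound hμ hP hq hM hb hν hab hE hv
  have hk0 : (0 : ℝ) ≤ k := k.cast_nonneg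
  -- The exponent equals b(ν+1) + 2kb: one factor n^(a+kb) comes from the scaled bound, one from the
  -- normalisation, and n from K/n.
  have hexp : 0 < (a + k * b) + (a + k * b) + 1 := by
    have : 0 < b * (ν + 1) := mul_pos hb (by linarith)
    nlinarith
  set m : ℝ := M k * k.factorial ^ 2 with hm
  have hm0 : 0 < m := by have := hM k hk; positivity
  have hlim : Tendsto (fun n : ℕ => K / m * ((n : ℝ) ^ ((a + k * b) + (a + k * b) + 1))⁻¹) atTop
      (𝓝 0) := by
    have := (((tendsto_rpow_atTop hexp).comp tendsto_natCast_atTop_atTop).inv_tendsto_atTop).const_mul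
      (K / m)
    simpa using this
  refine squeeze_zero_norm' ?_ hlim
  filter_upwards [hK, eventually_gt_atTop 0] with n hn hn0
  have hn' : (0 : ℝ) < n := by exact_mod_cast hn0
  have h1 := hn.1 ⟨k, by omega⟩
  have hS := Real.rpow_pos_of_pos hn' (a + k * b)
  simp only [← hm] at h1
  rw [abs_mul, abs_mul, abs_of_pos hm0, abs_of_pos hS, le_div_iff₀ hn'] at h1
  rw [Real.norm_eq_abs, abs_div, abs_of_pos hS, Real.rpow_add_one hn'.ne', Real.rpow_add hn' (a + k * b),
    ← div_eq_mul_inv, div_div, div_le_div_iff₀ hS (by positivity)]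
  calc |(taylor c (q n)).coeff k| * (m * ((n : ℝ) ^ (a + k * b) * (n : ℝ) ^ (a + k * b) * n))
      = (m * |(taylor c (q n)).coeff k| * (n : ℝ) ^ (a + k * b) * n) * (n : ℝ) ^ (a + k * b) := by
        ring
    _ ≤ K * (n : ℝ) ^ (a + k * b) := by gcongr

end Sobolev

/-! ### Limits of the connection coefficients -/

theorem tendsto_comp_sub_div_rpow {x : ℕ → ℝ} {s L : ℝ} (j : ℕ)
    (h : Tendsto (fun n : ℕ => x n / (n : ℝ) ^ s) atTop (𝓝 L)) :
    Tendsto (fun n : ℕ => x (n - j) / (n : ℝ) ^ s) atTop (𝓝 L) := by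
  have h1 := h.comp (tendsto_sub_atTop_nat j)
  have h2 : Tendsto (fun n : ℕ => ((n - j : ℕ) : ℝ) / n) atTop (𝓝 1) := by
    have : Tendsto (fun n : ℕ => 1 - (j : ℝ) / n) atTop (𝓝 1) := by
      simpa using (tendsto_const_div_atTop_nhds_zero_nat (j : ℝ)).const_sub 1
    refine this.congr' ?_
    filter_upwards [eventually_ge_atTop (j + 1)] with n hn
    have : (n : ℝ) ≠ 0 := by exact_mod_cast (by omega : n ≠ 0)
    rw [Nat.cast_sub (by omega)]
    field_simp
  have h3 := h1.mul (h2.rpow_const (p := s) (Or.inl one_ne_zero))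
  rw [Real.one_rpow, mul_one] at h3
  refine h3.congr' ?_
  filter_upwards [eventually_ge_atTop (j + 1)] with n hn
  have hm : (0 : ℝ) < ((n - j : ℕ) : ℝ) := by exact_mod_cast (by omega : 0 < n - j)
  have := (Real.rpow_pos_of_pos hm s).ne'
  simp only [Function.comp_apply]
  rw [Real.div_rpow hm.le n.cast_nonneg]
  field_simp

theorem tendsto_comp_sub_div_self {x : ℕ → ℝ} {s L : ℝ} (hL : L ≠ 0) (j : ℕ)
    (h : Tendsto (fun n : ℕ => x n / (n : ℝ) ^ s) atTop (𝓝 L)) :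
    Tendsto (fun n : ℕ => x (n - j) / x n) atTop (𝓝 1) := by
  have h1 := (tendsto_comp_sub_div_rpow j h).div h hL
  rw [div_self hL] at h1
  refine h1.congr' ?_
  filter_upwards [eventually_gt_atTop 0] with n hn
  have := (Real.rpow_pos_of_pos (by exact_mod_cast hn : (0 : ℝ) < n) s).ne'
  simp only [Pi.div_apply]
  rw [div_div_div_cancel_right₀ this]

theorem tendsto_div_rpow_of_tendsto_div_mul_rpow {x : ℕ → ℝ} {A s : ℝ} (hA : A ≠ 0)
    (h : Tendsto (fun n : ℕ => x n / (A * (n : ℝ) ^ s)) atTop (𝓝 1)) :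
    Tendsto (fun n : ℕ => x n / (n : ℝ) ^ s) atTop (𝓝 A) := by
  have h1 := h.mul_const A
  rw [one_mul] at h1
  refine h1.congr fun n => ?_
  rw [div_mul_eq_mul_div, mul_comm A, mul_div_mul_right _ _ hA]

theorem tendsto_taylor_coeff_div_rpow {c σ : ℝ} (hσ : -1 < σ) {α β : ℕ → ℝ} {A B a b : ℝ}
    {P : ℕ → ℝ[X]} {j : ℕ} (hA : A ≠ 0) (hB : B ≠ 0)
    (hα : Tendsto (fun n : ℕ => (√(α n))⁻¹ / (n : ℝ) ^ a) atTop (𝓝 A))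
    (hβ : Tendsto (fun n : ℕ => β n / (n : ℝ) ^ b) atTop (𝓝 B))
    (h : TendstoUniformlyOnCompacts
      (fun n z => (-1) ^ n * ((√(α n) / β n ^ j : ℝ) : ℂ) *
        aeval ((c : ℂ) + z ^ 2 / (β n : ℂ)) (P n)) (besselQuot σ σ)) (k : ℕ) :
    Tendsto (fun n : ℕ => (-1) ^ n * (taylor c (P n)).coeff k / (n : ℝ) ^ (a + (k + j : ℕ) * b))
      atTop (𝓝 (besselCoeff σ k * A * B ^ (k + j))) := by
  have h0 : TendstoUniformlyOnCompacts
      (fun n z => (((-1) ^ n * (√(α n) / β n ^ j) : ℝ) : ℂ) *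
        aeval ((c : ℂ) + z ^ 2 / (β n : ℂ)) (P n)) (besselQuot σ σ) := by
    simpa using h
  have h1 := ((tendsto_taylor_coeff_of_mehlerHeine hσ h0 k).mul hα).mul (hβ.pow (k + j))
  refine h1.congr' ?_
  filter_upwards [eventually_gt_atTop 0, hα.eventually_ne hA, hβ.eventually_ne hB] with n hn h2 h3
  have hn' : (0 : ℝ) < n := by exact_mod_cast hn
  -- In Lean the inverse of 0 is 0, so a nonzero limit excludes a vanishing square root.
  have h4 : √(α n) ≠ 0 := by rintro h; simp [h] at h2
  have h5 : β n ≠ 0 := by rintro h; simp [h] at h3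
  rw [Real.rpow_add hn', mul_comm _ b, Real.rpow_mul hn'.le, Real.rpow_natCast]
  have h6 := (Real.rpow_pos_of_pos hn' a).ne'
  have h7 := (Real.rpow_pos_of_pos hn' b).ne'
  rw [div_pow, pow_add (β n)]
  field_simp

/-- Forward substitution: the limiting system is lower triangular with nonzero diagonal and zero
right-hand side. -/
theorem tendsto_zero_of_triangular {r : ℕ} {l x : ℕ → ℕ → ℝ} {R : ℕ → ℕ → ℕ → ℝ}
    {E : ℕ → ℕ → ℝ} (hx : ∀ k ≤ r, Tendsto (x k) atTop (𝓝 0))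
    (hR : ∀ k ≤ r, ∀ j ≤ k, Tendsto (R k j) atTop (𝓝 (E k j))) (hE : ∀ k ≤ r, E k k ≠ 0)
    (h : ∀ k ≤ r, ∀ᶠ n in atTop, x k n = ∑ j ∈ Finset.range (k + 1), l j n * R k j n)
    {k : ℕ} (hk : k ≤ r) : Tendsto (l k) atTop (𝓝 0) := by
  induction k using Nat.strong_induction_on with
  | _ k ih =>
    have h1 : Tendsto (fun n => (x k n - ∑ j ∈ Finset.range k, l j n * R k j n) / R k k n) atTop
        (𝓝 ((0 - ∑ j ∈ Finset.range k, 0 * E k j) / E k k)) := by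
      refine ((hx k hk).sub (tendsto_finsetSum _ fun j hj => ?_)).div (hR k hk k le_rfl) (hE k hk)
      have hj' := Finset.mem_range.mp hj
      exact (ih j hj' (by omega)).mul (hR k hk j hj'.le)
    simp only [zero_mul, Finset.sum_const_zero, sub_zero, zero_div] at h1
    refine h1.congr' ?_
    filter_upwards [h k hk, (hR k hk k le_rfl).eventually_ne (hE k hk)] with n hn hn'
    rw [hn, Finset.sum_range_succ, add_sub_cancel_left, mul_div_cancel_right₀ _ hn']

theorem tendsto_sum_mul_of_bounded {m : ℕ} {l g : ℕ → ℕ → ℝ}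
    (hl : ∀ j < m, Tendsto (l j) atTop (𝓝 0)) (hg : ∀ᶠ n in atTop, ∀ j < m, |g j n| ≤ 1) :
    Tendsto (fun n => ∑ j ∈ Finset.range m, l j n * g j n) atTop (𝓝 0) := by
  have h1 : Tendsto (fun n => ∑ j ∈ Finset.range m, |l j n|) atTop (𝓝 0) := by
    have := tendsto_finsetSum (Finset.range m) fun j hj => (hl j (Finset.mem_range.mp hj)).abs
    simpa using this
  refine squeeze_zero_norm' ?_ h1
  filter_upwards [hg] with n hn
  refine (Finset.abs_sum_le_sum_abs _ _).trans (Finset.sum_le_sum fun j hj => ?_)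
  rw [abs_mul]
  exact mul_le_of_le_one_right (abs_nonneg _) (hn j (Finset.mem_range.mp hj))

section Connection

variable {μ : Measure ℝ} (hμ : ∀ n : ℕ, Integrable (fun x : ℝ => x ^ n) μ)
  {c : ℝ} {r : ℕ} {M : ℕ → ℝ} {p : ℕ → ℕ → ℝ[X]} {q : ℕ → ℝ[X]}

/-- Pairing q_n with P_n bounds the last coefficient below by κ_n - o(1); pairing it with the unit
vector `e (r+1) n` bounds it above by 1 + o(1). -/
theorem tendsto_last_connection_coeff (hM : ∀ i ≤ r, 0 < M i)
    (hp : ∀ j ≤ r + 1, IsOrthonormalPolynomials (fun f g => christoffelBilin hμ c j f g) (p j))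
    (hP : IsOrthonormalPolynomials (fun f g => integralBilin μ hμ f g) (p 0))
    (hq : IsOrthonormalPolynomials (fun f g => sobolevBilin hμ c r M f g) q)
    (hκ : Tendsto (fun n => integralBilin μ hμ (q n) (p 0 n)) atTop (𝓝 1))
    {l : ℕ → ℕ → ℝ} (hl0 : ∀ j ≤ r, Tendsto (l j) atTop (𝓝 0))
    (hl : ∀ᶠ n in atTop,
      q n = ∑ j ∈ Finset.range (r + 2), C (l j n) * (X - C c) ^ j * p j (n - j)) :
    Tendsto (l (r + 1)) atTop (𝓝 1) := by
  set e : ℕ → ℕ → ℝ[X] := fun j n => (X - C c) ^ j * p j (n - j) with he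
  have hee : ∀ j ≤ r + 1, ∀ n, integralBilin μ hμ (e j n) (e j n) ≤ 1 := fun j hj n => by
    have := (hp j hj).orthonormal (n - j) (n - j)
    rw [if_pos rfl] at this
    exact this.le
  have hPP : ∀ n, integralBilin μ hμ (p 0 n) (p 0 n) ≤ 1 := fun n => by
    have := hP.orthonormal n n
    rw [if_pos rfl] at this
    exact this.le
  have hS := tendsto_sum_mul_of_bounded (m := r + 1) (l := l)
    (g := fun j n => integralBilin μ hμ (e j n) (e (r + 1) n)) (fun j hj => hl0 j (by omega))
    (Eventually.of_forall fun n j hj =>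
      integralBilin_abs_le_one hμ (hee j hj.le n) (hee (r + 1) le_rfl n))
  have hS' := tendsto_sum_mul_of_bounded (m := r + 1) (l := l)
    (g := fun j n => integralBilin μ hμ (e j n) (p 0 n)) (fun j hj => hl0 j (by omega))
    (Eventually.of_forall fun n j hj => integralBilin_abs_le_one hμ (hee j hj.le n) (hPP n))
  have hlow := hκ.sub hS'
  have hup := hS.const_sub 1
  rw [sub_zero] at hlow hup
  have hexp : ∀ᶠ n in atTop, ∀ f, integralBilin μ hμ (q n) f =
      ∑ j ∈ Finset.range (r + 1), l j n * integralBilin μ hμ (e j n) f +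
        l (r + 1) n * integralBilin μ hμ (e (r + 1) n) f := by
    filter_upwards [hl] with n hn f
    have : q n = ∑ j ∈ Finset.range (r + 2), l j n • e j n := by
      rw [hn]
      exact Finset.sum_congr rfl fun j _ => by rw [smul_eq_C_mul, he, mul_assoc]
    rw [this, map_sum, LinearMap.sum_apply, Finset.sum_range_succ]
    simp only [map_smul, LinearMap.smul_apply, smul_eq_mul]
  refine tendsto_of_tendsto_of_tendsto_of_le_of_le' hlow hup ?_ ?_
  -- The product of the last coefficient with ρ = ∫ e_{r+1} P_n dμ is eventually positive. As 0 < ρ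
  -- ≤ 1, by leading coefficients and Cauchy–Schwarz, the last coefficient is positive and dominates
  -- the product.
  · filter_upwards [hexp, hlow.eventually (lt_mem_nhds one_pos), eventually_ge_atTop (r + 1)]
      with n hn hpos hnr
    have h1 := hn (p 0 n)
    have hρ1 := integralBilin_le_one hμ (hee (r + 1) le_rfl n) (hPP n)
    have hdeg : (e (r + 1) n).degree = n := by
      rw [he, degree_X_sub_C_pow_mul, (hp (r + 1) le_rfl).degree_eq]
      norm_cast
      omega
    have hρ0 : 0 < integralBilin μ hμ (e (r + 1) n) (p 0 n) := by
      rw [hP.apply_eq_div (by rw [hdeg]; exact_mod_cast n.lt_succ_self)]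
      refine div_pos ?_ (hP.coeff_pos n)
      have h2 := leadingCoeff_X_sub_C_pow_mul c (r + 1) (p (r + 1) (n - (r + 1)))
      change (e (r + 1) n).leadingCoeff = _ at h2
      rw [leadingCoeff, natDegree_eq_of_degree_eq_some hdeg] at h2
      rw [h2]
      exact (hp (r + 1) le_rfl).leadingCoeff_pos _
    have h3 : integralBilin μ hμ (q n) (p 0 n) -
        ∑ j ∈ Finset.range (r + 1), l j n * integralBilin μ hμ (e j n) (p 0 n) =
        l (r + 1) n * integralBilin μ hμ (e (r + 1) n) (p 0 n) := by linarith
    rw [h3] at hpos ⊢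
    exact mul_le_of_le_one_right (pos_of_mul_pos_left hpos hρ0.le).le hρ1
  · filter_upwards [hexp, eventually_ge_atTop (r + 1)] with n hn hnr
    have h1 := hn (e (r + 1) n)
    have h2 := integralBilin_le_one hμ (sobolev_integralBilin_self_le_one hμ hM hq n)
      (hee (r + 1) le_rfl n)
    have h3 : integralBilin μ hμ (e (r + 1) n) (e (r + 1) n) = 1 := by
      have := (hp (r + 1) le_rfl).orthonormal (n - (r + 1)) (n - (r + 1))
      rwa [if_pos rfl] at this
    rw [h3, mul_one] at h1
    linarith

end Connection

/-! ### Mehler–Heine asymptotics from the connection formula -/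

theorem tendsto_prod_comp_sub_mul {F : ℕ → ℂ → ℂ} {L x : ℂ} {θ : ℕ → ℝ}
    (hF : Tendsto (fun y : ℕ × ℂ => F y.1 y.2) (atTop ×ˢ 𝓝 x) (𝓝 L))
    (hθ : Tendsto θ atTop (𝓝 1)) (j : ℕ) :
    Tendsto (fun y : ℕ × ℂ => F (y.1 - j) (θ y.1 * y.2)) (atTop ×ˢ 𝓝 x) (𝓝 L) := by
  have h4 : Tendsto (fun y : ℕ × ℂ => (y.1 - j, (θ y.1 : ℂ) * y.2))
      (atTop ×ˢ 𝓝 x) (atTop ×ˢ 𝓝 x) := by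
    refine ((tendsto_sub_atTop_nat j).comp tendsto_fst).prodMk ?_
    have := (((Complex.continuous_ofReal.tendsto 1).comp hθ).comp
      (tendsto_fst (g := 𝓝 x))).mul tendsto_snd
    simpa using this
  exact hF.comp h4

/-- At x = c + z²/β_n the factor (x-c)^j is z^(2j)/β_n^j, which supplies the normalisation of `p j`.
Replacing n by n-j changes it only by ratios tending to 1, and bounded limits times vanishing
coefficients disappear. -/
theorem mehlerHeine_of_connection {c ν : ℝ} (hν : -1 < ν) {r : ℕ} {p : ℕ → ℕ → ℝ[X]}
    {q : ℕ → ℝ[X]} {α β : ℕ → ℝ} {A B a b : ℝ} (hA : 0 < A) (hB : 0 < B)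
    (hα : Tendsto (fun n : ℕ => (√(α n))⁻¹ / (n : ℝ) ^ a) atTop (𝓝 A))
    (hβ : Tendsto (fun n : ℕ => β n / (n : ℝ) ^ b) atTop (𝓝 B))
    (hMH : ∀ j ≤ r + 1, TendstoUniformlyOnCompacts
      (fun n z => (-1) ^ n * ((√(α n) / β n ^ j : ℝ) : ℂ) *
        aeval ((c : ℂ) + z ^ 2 / (β n : ℂ)) (p j n))
      (besselQuot (ν + 2 * j) (ν + 2 * j)))
    {l : ℕ → ℕ → ℝ} (hl0 : ∀ j ≤ r, Tendsto (l j) atTop (𝓝 0))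
    (hl1 : Tendsto (l (r + 1)) atTop (𝓝 1))
    (hl : ∀ᶠ n in atTop,
      q n = ∑ j ∈ Finset.range (r + 2), C (l j n) * (X - C c) ^ j * p j (n - j)) :
    TendstoUniformlyOnCompacts
      (fun n z => (-1) ^ n * ((√(α n) : ℝ) : ℂ) *
        aeval ((c : ℂ) + z ^ 2 / (β n : ℂ)) (q n))
      (fun z => (-1) ^ (r + 1) * besselQuot ν (ν + 2 * r + 2) z) := by
  set F : ℕ → ℕ → ℂ → ℂ := fun j n z => (-1) ^ n * ((√(α n) / β n ^ j : ℝ) : ℂ) *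
        aeval ((c : ℂ) + z ^ 2 / (β n : ℂ)) (p j n) with hF
  have hFc : ∀ j n, Continuous (F j n) := fun j n => by
    simp only [hF]
    refine continuous_const.mul ?_
    exact (p j n).continuous_aeval.comp (by fun_prop)
  have hFp : ∀ j ≤ r + 1, ∀ x, Tendsto (fun y : ℕ × ℂ => F j y.1 y.2) (atTop ×ˢ 𝓝 x)
      (𝓝 (besselQuot (ν + 2 * j) (ν + 2 * j) x)) := fun j hj x =>
    TendstoUniformlyOnCompacts.tendsto_prod (F := F j) (hMH j hj) (hFc j) x
  -- The target is z^(2r+2) times the limit function belonging to j = r+1.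
  have hlim : (fun z => (-1) ^ (r + 1) * besselQuot ν (ν + 2 * r + 2) z) = fun z : ℂ =>
      (-1) ^ (r + 1) * (z ^ (2 * (r + 1)) *
        besselQuot (ν + 2 * (r + 1 : ℕ)) (ν + 2 * (r + 1 : ℕ)) z) := by
    have hr : (0 : ℝ) ≤ r := r.cast_nonneg
    have hτ : ν + 2 * r + 2 = ν + 2 * (r + 1 : ℕ) := by push_cast; ring
    funext z
    rw [hτ, besselQuot_eq (σ := ν) (m := r + 1) (by push_cast; linarith) rfl,
      besselQuot_eq (σ := ν + 2 * (r + 1 : ℕ)) (m := 0) (by push_cast; linarith) (by simp)]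
    simp
  rw [hlim]
  have hcont : Continuous (besselQuot (ν + 2 * (r + 1 : ℕ)) (ν + 2 * (r + 1 : ℕ))) :=
    (hMH (r + 1) le_rfl).continuous (hFc _)
  refine TendstoUniformlyOnCompacts.of_tendsto_prod (by fun_prop) fun x => ?_
  have hβr := fun j => tendsto_comp_sub_div_self hB.ne' j hβ
  have hαr := fun j => tendsto_comp_sub_div_self hA.ne' j hα
  have hαr' : ∀ j, Tendsto (fun n => √(α n) / √(α (n - j))) atTop (𝓝 1) := fun j =>
    (hαr j).congr fun n => by rw [inv_div_inv]
  have hθ : ∀ j, Tendsto (fun n => √(β (n - j) / β n)) atTop (𝓝 1) := fun j => by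
    simpa using (hβr j).sqrt
  -- The j-th term of the rescaled connection formula. The factor √(β_{n-j}/β_n) makes the point c +
  -- z²/β_n fit the scaling at index n-j, and (-1)^j compensates for (-1)^(n-j).
  let G : ℕ → ℕ → ℂ → ℂ := fun j n z => (-1) ^ j * z ^ (2 * j) *
    ((l j n * (√(α n) / √(α (n - j)) * (β (n - j) / β n) ^ j) : ℝ) : ℂ) *
      F j (n - j) ((√(β (n - j) / β n) : ℝ) * z)
  have hterm : ∀ j ≤ r + 1, ∀ L : ℝ, Tendsto (l j) atTop (𝓝 L) →
      Tendsto (fun y : ℕ × ℂ => G j y.1 y.2) (atTop ×ˢ 𝓝 x)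
        (𝓝 ((-1) ^ j * x ^ (2 * j) * (L : ℂ) * besselQuot (ν + 2 * j) (ν + 2 * j) x)) := by
    intro j hj L hL
    have h1 : Tendsto (fun y : ℕ × ℂ => (-1) ^ j * y.2 ^ (2 * j)) (atTop ×ˢ 𝓝 x)
        (𝓝 ((-1) ^ j * x ^ (2 * j))) := (tendsto_snd.pow _).const_mul _
    have h2 : Tendsto (fun n => l j n * (√(α n) / √(α (n - j)) * (β (n - j) / β n) ^ j)) atTop
        (𝓝 L) := by
      simpa using hL.mul ((hαr' j).mul ((hβr j).pow j))
    have h3 : Tendsto (fun y : ℕ × ℂ =>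
        ((l j y.1 * (√(α y.1) / √(α (y.1 - j)) * (β (y.1 - j) / β y.1) ^ j) : ℝ) : ℂ))
        (atTop ×ˢ 𝓝 x) (𝓝 (L : ℂ)) :=
      ((Complex.continuous_ofReal.tendsto L).comp h2).comp tendsto_fst
    have h5 : Tendsto (fun y : ℕ × ℂ => F j (y.1 - j) ((√(β (y.1 - j) / β y.1) : ℝ) * y.2))
        (atTop ×ˢ 𝓝 x) (𝓝 (besselQuot (ν + 2 * j) (ν + 2 * j) x)) :=
      tendsto_prod_comp_sub_mul (hFp j hj x) (hθ j) j
    exact (h1.mul h3).mul h5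
  have hsum : Tendsto (fun y : ℕ × ℂ => ∑ j ∈ Finset.range (r + 2), G j y.1 y.2) (atTop ×ˢ 𝓝 x)
      (𝓝 ((-1) ^ (r + 1) * (x ^ (2 * (r + 1)) *
        besselQuot (ν + 2 * (r + 1 : ℕ)) (ν + 2 * (r + 1 : ℕ)) x))) := by
    have h0 : Tendsto (fun y : ℕ × ℂ => ∑ j ∈ Finset.range (r + 1), G j y.1 y.2) (atTop ×ˢ 𝓝 x)
        (𝓝 (∑ j ∈ Finset.range (r + 1), 0)) := by
      refine tendsto_finsetSum _ fun j hj => ?_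
      have hj' := Finset.mem_range.mp hj
      simpa only [Complex.ofReal_zero, mul_zero, zero_mul] using
        hterm j hj'.le 0 (hl0 j (by omega))
    have h1 := h0.add (hterm (r + 1) le_rfl 1 hl1)
    simp only [Finset.sum_range_succ _ (r + 1)]
    rwa [Finset.sum_const_zero, zero_add, Complex.ofReal_one, mul_one, mul_assoc] at h1
  refine hsum.congr' ?_
  have hpos : ∀ᶠ n in atTop, √(α n) ≠ 0 ∧ 0 < β n := by
    filter_upwards [hα.eventually_ne hA.ne', hβ.eventually (lt_mem_nhds hB), eventually_gt_atTop 0]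
      with n h1 h2 hn
    refine ⟨by rintro h; simp [h] at h1, ?_⟩
    have := Real.rpow_pos_of_pos (by exact_mod_cast hn : (0 : ℝ) < n) b
    exact (div_pos_iff_of_pos_right this).mp h2
  have hposj : ∀ᶠ n in atTop, ∀ j ∈ Finset.range (r + 2), √(α (n - j)) ≠ 0 ∧ 0 < β (n - j) :=
    (Finset.eventually_all _).mpr fun j _ => (tendsto_sub_atTop_nat j).eventually hpos
  have hev : ∀ᶠ n in atTop, ∀ z : ℂ, ∑ j ∈ Finset.range (r + 2), G j n z =
      (-1) ^ n * ((√(α n) : ℝ) : ℂ) * aeval ((c : ℂ) + z ^ 2 / (β n : ℂ)) (q n) := by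
    filter_upwards [hpos, hposj, hl, eventually_ge_atTop (r + 1)] with n h1 h2 h3 h4 z
    rw [h3, map_sum, Finset.mul_sum]
    refine Finset.sum_congr rfl fun j hj => ?_
    obtain ⟨ha, hb⟩ := h2 j hj
    have hjn : j ≤ n := by have := Finset.mem_range.mp hj; omega
    have hβn : (β n : ℂ) ≠ 0 := by exact_mod_cast h1.2.ne'
    have hβm : (β (n - j) : ℂ) ≠ 0 := by exact_mod_cast hb.ne'
    have hαm : (√(α (n - j)) : ℂ) ≠ 0 := by exact_mod_cast ha
    have harg : (((√(β (n - j) / β n) : ℝ) : ℂ) * z) ^ 2 / (β (n - j) : ℂ) =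
        z ^ 2 / (β n : ℂ) := by
      rw [mul_pow, ← Complex.ofReal_pow, Real.sq_sqrt (div_pos hb h1.2).le]
      push_cast
      field_simp
    have hsgn : ((-1 : ℂ)) ^ n = (-1) ^ j * (-1) ^ (n - j) := by
      rw [← pow_add, Nat.add_sub_cancel' hjn]
    simp only [G, hF, harg, map_mul, map_pow, map_sub, aeval_X, aeval_C, Complex.coe_algebraMap,
      add_sub_cancel_left, hsgn]
    push_cast
    rw [div_pow, div_pow, pow_mul]
    field_simp
  exact (hev.prod_inl (𝓝 x)).mono fun y hy => hy y.2

/-! ### The main theorem -/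

theorem mainTheorem1
    (μ : Measure ℝ) [IsFiniteMeasure μ]
    (hμ_inf : μ.support.Infinite)
    (hμ_mom : ∀ n : ℕ, Integrable (fun x : ℝ => x ^ n) μ)
    (I : Set ℝ) (hI : I.OrdConnected) (hμI : μ Iᶜ = 0)
    (c : ℝ) (hc : IsGLB I c)
    (r : ℕ) (M : ℕ → ℝ) (hM : ∀ i ≤ r, 0 < M i)
    -- `p j n` is the polynomial `p_n^{[2j]}`, `q n` the discrete Sobolev polynomial `q_n`
    (p : ℕ → ℕ → ℝ[X])
    (hp : ∀ j ≤ r + 1, IsOrthonormalPolynomials (integralForm (christoffelMeasure μ c j)) (p j))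
    (q : ℕ → ℝ[X]) (hq : IsOrthonormalPolynomials (sobolevForm μ c r M) q)
    (α β : ℕ → ℝ) (A B a b ν : ℝ) (hA : 0 < A) (hB : 0 < B) (hb : 0 < b) (hν : -1 < ν)
    (hα : Tendsto (fun n : ℕ => (√(α n))⁻¹ / (A * (n : ℝ) ^ a)) atTop (𝓝 1))
    (hβ : Tendsto (fun n : ℕ => β n / (B * (n : ℝ) ^ b)) atTop (𝓝 1))
    (hab : 2 * a + 1 = b * (ν + 1))
    (hMH : ∀ j ≤ r + 1, TendstoUniformlyOnCompacts
      (fun n z => (-1) ^ n * ((√(α n) / β n ^ j : ℝ) : ℂ) *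
        aeval ((c : ℂ) + z ^ 2 / (β n : ℂ)) (p j n))
      (besselQuot (ν + 2 * j) (ν + 2 * j))) :
    -- Mehler–Heine asymptotics of `q_n`
    TendstoUniformlyOnCompacts
      (fun n z => (-1) ^ n * ((√(α n) : ℝ) : ℂ) *
        aeval ((c : ℂ) + z ^ 2 / (β n : ℂ)) (q n))
      (fun z => (-1) ^ (r + 1) * besselQuot ν (ν + 2 * r + 2) z) ∧
    -- the connection formula exists for all `n ≥ r + 1`
    (∀ n ≥ r + 1, ∃ l : ℕ → ℝ,
      q n = ∑ j ∈ Finset.range (r + 2), C (l j) * (X - C c) ^ j * p j (n - j)) ∧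
    -- its coefficients tend to `0`, except the last one, which tends to `1`
    (∀ l : ℕ → ℕ → ℝ,
      (∀ᶠ n in atTop,
        q n = ∑ j ∈ Finset.range (r + 2), C (l j n) * (X - C c) ^ j * p j (n - j)) →
      (∀ j ≤ r, Tendsto (l j) atTop (𝓝 0)) ∧ Tendsto (l (r + 1)) atTop (𝓝 1)) := by
  have hcae : ∀ᵐ x ∂μ, c ≤ x := by
    have : ∀ᵐ x ∂μ, x ∈ I := hμI
    filter_upwards [this] with x hx using hc.1 hx
  have hpB : ∀ j ≤ r + 1,
      IsOrthonormalPolynomials (fun f g => christoffelBilin hμ_mom c j f g) (p j) :=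
    fun j hj => (hp j hj).christoffel hμ_mom
  have hP : IsOrthonormalPolynomials (fun f g => integralBilin μ hμ_mom f g) (p 0) := by
    simpa only [christoffelBilin_apply, pow_zero, one_mul] using hpB 0 (Nat.zero_le _)
  have hqB : IsOrthonormalPolynomials (fun f g => sobolevBilin hμ_mom c r M f g) q := hq
  have hα' := tendsto_div_rpow_of_tendsto_div_mul_rpow hA.ne' hα
  have hβ' := tendsto_div_rpow_of_tendsto_div_mul_rpow hB.ne' hβ
  have hσ : ∀ j : ℕ, -1 < ν + 2 * j := fun j => by
    have : (0 : ℝ) ≤ j := j.cast_nonneg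
    linarith
  have hcoeff := fun j hj k =>
    tendsto_taylor_coeff_div_rpow (hσ j) hA.ne' hB.ne' hα' hβ' (hMH j hj) k
  have hne : ∀ j k : ℕ, besselCoeff (ν + 2 * j) k * A * B ^ (k + j) ≠ 0 := fun j k =>
    mul_ne_zero (mul_ne_zero (besselCoeff_ne_zero (hσ j) k) hA.ne') (pow_ne_zero _ hB.ne')
  have hconn : ∀ n ≥ r + 1, ∃ l : ℕ → ℝ,
      q n = ∑ j ∈ Finset.range (r + 2), C (l j) * (X - C c) ^ j * p j (n - j) := fun n hn =>
    exists_connection_formula hμ_mom hμ_inf hcae hpB hqB hn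
  have hE0 : ∀ k ≤ r, besselCoeff (ν + 2 * (0 : ℕ)) k * A * B ^ (k + 0) ≠ 0 := fun k _ => hne 0 k
  have hv : ∀ k ≤ r, Tendsto
      (fun n : ℕ => (-1) ^ n * (taylor c (p 0 n)).coeff k / (n : ℝ) ^ (a + k * b)) atTop
      (𝓝 (besselCoeff (ν + 2 * (0 : ℕ)) k * A * B ^ (k + 0))) := fun k _ => by
    simpa only [Nat.add_zero] using hcoeff 0 (Nat.zero_le _) k
  have hκ := tendsto_sobolev_connection hμ_mom hP hqB hM hb hν hab hE0 hv
  have hlims : ∀ l : ℕ → ℕ → ℝ,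
      (∀ᶠ n in atTop,
        q n = ∑ j ∈ Finset.range (r + 2), C (l j n) * (X - C c) ^ j * p j (n - j)) →
      (∀ j ≤ r, Tendsto (l j) atTop (𝓝 0)) ∧ Tendsto (l (r + 1)) atTop (𝓝 1) := by
    intro l hl
    have hl0 : ∀ j ≤ r, Tendsto (l j) atTop (𝓝 0) := fun j hj =>
      tendsto_zero_of_triangular
        -- The sign (-1)^n makes the matrix entries converge; it is harmless on the left, which
        -- tends to 0.
        (x := fun k n => (-1) ^ n * ((taylor c (q n)).coeff k / (n : ℝ) ^ (a + k * b)))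
        (R := fun k j n =>
          (-1) ^ n * (taylor c (p j (n - j))).coeff (k - j) / (n : ℝ) ^ (a + k * b))
        (E := fun k j => (-1) ^ j * (besselCoeff (ν + 2 * j) (k - j) * A * B ^ (k - j + j)))
        (fun k hk => by
          refine squeeze_zero_norm (fun n => ?_) (tendsto_zero_iff_norm_tendsto_zero.mp
            (tendsto_sobolev_taylor_coeff hμ_mom hP hqB hM hb hν hab hE0 hv hk))
          simp)
        (fun k hk j hjk => by
          have h1 := (tendsto_comp_sub_div_rpow j (hcoeff j (by omega) (k - j))).const_mul
            ((-1) ^ j)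
          refine h1.congr' ?_
          filter_upwards [eventually_ge_atTop j] with n hn
          rw [Nat.sub_add_cancel hjk, ← mul_div_assoc, ← mul_assoc, ← pow_add,
            Nat.add_sub_cancel' hn])
        (fun k _ => mul_ne_zero (pow_ne_zero _ (by norm_num)) (hne k (k - k)))
        (fun k hk => by
          filter_upwards [hl] with n hn
          have h1 : (taylor c (q n)).coeff k = ∑ j ∈ Finset.range (r + 2),
              l j n * if j ≤ k then (taylor c (p j (n - j))).coeff (k - j) else 0 := by
            rw [hn, map_sum, finsetSum_coeff]
            refine Finset.sum_congr rfl fun j _ => ?_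
            rw [mul_assoc, ← smul_eq_C_mul, map_smul, coeff_smul, coeff_taylor_X_sub_C_pow_mul,
              smul_eq_mul]
          have h2 : ∑ j ∈ Finset.range (k + 1),
              (l j n * if j ≤ k then (taylor c (p j (n - j))).coeff (k - j) else 0) =
              ∑ j ∈ Finset.range (r + 2),
                l j n * if j ≤ k then (taylor c (p j (n - j))).coeff (k - j) else 0 := by
            -- Terms with j > k carry a factor (x-c)^j and do not reach order k, so the system is
            -- triangular.
            refine Finset.sum_subset (Finset.range_mono (by omega)) fun j _ hj => ?_
            rw [if_neg (by simpa using hj), mul_zero]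
          rw [h1, ← h2, Finset.sum_div, Finset.mul_sum]
          refine Finset.sum_congr rfl fun j hj => ?_
          rw [if_pos (by have := Finset.mem_range.mp hj; omega)]
          ring) hj
    exact ⟨hl0, tendsto_last_connection_coeff hμ_mom hM hpB hP hqB hκ hl0 hl⟩
  refine ⟨?_, hconn, hlims⟩
  -- For n ≤ r the coefficients get the default value 0, so that one total family can be chosen.
  have hex : ∀ n, ∃ l : ℕ → ℝ, r + 1 ≤ n →
      q n = ∑ j ∈ Finset.range (r + 2), C (l j) * (X - C c) ^ j * p j (n - j) := fun n => by
    by_cases hn : r + 1 ≤ n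
    · obtain ⟨l, hl⟩ := hconn n hn
      exact ⟨l, fun _ => hl⟩
    · exact ⟨0, fun h => absurd h hn⟩
  choose l hl using hex
  have hl' : ∀ᶠ n in atTop,
      q n = ∑ j ∈ Finset.range (r + 2), C (l n j) * (X - C c) ^ j * p j (n - j) := by
    filter_upwards [eventually_ge_atTop (r + 1)] with n hn using hl n hn
  obtain ⟨h0, h1⟩ := hlims (fun j n => l n j) hl'
  exact mehlerHeine_of_connection hν hA hB hα' hβ' hMH h0 h1 hl'
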